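/- Let $N\ge 2$, let $\mathcal J=\{1,\dots,N\}$, and let $\mathcal P$ be the set of nonempty subsets of $\mathcal J$. Let $(\Omega,\mathcal F,\mathbf P)$ be a probability space with a filtration $(\mathcal F_t)_{t\in\mathbb N}$; put $\mathcal F_\infty=\bigvee_{t}\mathcal F_t$ and $\bar{\mathbb N}=\mathbb N\cup\{\infty\}$. Stopping times take values in $\bar{\mathbb N}$, and $\mathcal T_t$ denotes the set of stopping times $\nu\ge t$. For $i\in\mathcal J$ and $I\in\mathcal P$ let $(X^{i,I}_t)_{t\in\bar{\mathbb N}}$ be a real-valued process such that $X^{i,I}_t$ is $\mathcal F_t$-measurable for every $t\in\bar{\mathbb N}$ and $\mathbf E[\sup_{t\in\bar{\mathbb N}}|X^{i,I}_t|]<\infty$. Assume (A) for all $i,j\in\mathcal J$ and all $t\in\mathbb N$: $X^{i,\{i,j\}}_t\le X^{i,\{j\}}_t$ $\mathbf P$-a.s. For stopping times $T_1,\dots,T_N$ let $R=T_1\wedge\dots\wedge T_N$ and $$J_i(T_1,\dots,T_N)=\sum_{I\in\mathcal P}X^{i,I}_R\,\mathbf 1_{\bigcap_{j\in I}\{T_j=R\}\cap\bigcap_{j\notin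 I}\{T_j>R\}},\qquad i\in\mathcal J .$$ Fix $\varepsilon>0$. For $n\ge1$ let $i_n\in\mathcal J$ be the index with $n\equiv i_n \pmod N$. Define $\tau_1=\dots=\tau_N=\infty$ and, for $n\ge N+1$, recursively (a) $\theta_n=\min\{\tau_{n-1},\dots,\tau_{n-N+1}\}$; (b) $I_n=\{i_l : n-N+1\le l\le n-1,\ \tau_l=\theta_n\}$; (c) $U^n_t=X^{i_n,\{i_n\}}_t\mathbf 1_{\{t<\theta_n\}}+Y^n\mathbf 1_{\{t\ge\theta_n\}}$ for $t\in\bar{\mathbb N}$, where $Y^n=\big(X^{i_n,I_n\cup\{i_n\}}_{\theta_n}\vee X^{i_n,I_n}_{\theta_n}\big)\mathbf 1_{\{\theta_n<\infty\}}+X^{i_n,\mathcal J}_\infty\mathbf 1_{\{\theta_n=\infty\}}$; (d) $W^n_t=\operatorname{ess\,sup}_{\nu\in\mathcal T_t}\mathbf E[U^n_\nu\mid\mathcal F_t]$ for $t\in\bar{\mathbb N}$, in an arbitrary real-valued $\mathcal F_t$-measurable version; (e) $\mu_n=\inf\{s\in\bar{\mathbb N}: W^n_s\le U^n_s+\varepsilon\}$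 (with $\inf\emptyset=\infty$); (f) $\tau_n=\mu_n\wedge\tau_{n-N}$ on $\{\mu_n\wedge\tau_{n-N}<\theta_n\}$, and $\tau_n=\tau_{n-N}$ on $\{\mu_n\wedge\tau_{n-N}\ge\theta_n\}$. Then this scheme can be carried out, and for every choice of the versions in (d) the following holds: all $\tau_n$ are stopping times; for every $i\in\mathcal J$ the sequence $(\tau_{Nq+i})_{q\ge0}$ is non-increasing, so that the limit $T_i^*=\lim_{q\to\infty}\tau_{Nq+i}$ exists; and $(T^*_1,\dots,T^*_N)$ is an $\varepsilon$-Nash equilibrium point in pure strategies, i.e. $T_1^*,\dots,T_N^*$ are stopping times and for every $i\in\mathcal J$ and every stopping time $T$ $$\mathbf E[J_i(T_1^*,\dots,T_{i-1}^*,T,T_{i+1}^*,\dots,T_N^*)]\le\mathbf E[J_i(T_1^*,\dots,T_N^*)]+\varepsilon .$$ -/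

import Mathlib

open MeasureTheory Filter Topology

noncomputable section

namespace DynkinGame

variable {Ω : Type*} {mΩ : MeasurableSpace Ω} {N : ℕ}

/-- The σ-algebras `ℱ_t` for `t ∈ ℕ ∪ {∞}`, with `ℱ_∞ = ⋁ n, ℱ_n`. -/
@[reducible]
def sigmaAt (ℱ : Filtration ℕ mΩ) : ℕ∞ → MeasurableSpace Ω
  | ⊤ => ⨆ n : ℕ, ℱ n
  | (n : ℕ) => ℱ n

/-- `Z` is (a version of) the essential supremum of the family `S` of random variables, and this
version is measurable with respect to the sub-σ-algebra `m`. -/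
structure IsEssSup (P : Measure Ω) (m : MeasurableSpace Ω) (S : Set (Ω → ℝ)) (Z : Ω → ℝ) :
    Prop where
  measurable : Measurable[m] Z
  upper : ∀ f ∈ S, f ≤ᵐ[P] Z
  least : ∀ Z' : Ω → ℝ, Measurable[mΩ] Z' → (∀ f ∈ S, f ≤ᵐ[P] Z') → Z ≤ᵐ[P] Z'

/-- `Z` is a version of `esssup_{ν ∈ 𝒯_t} E[U_ν | ℱ_t]`, where `𝒯_t` is the set of all
`ℕ ∪ {∞}`-valued stopping times `ν ≥ t`. -/
def IsSnellAt (ℱ : Filtration ℕ mΩ) (P : Measure Ω) (U : ℕ∞ → Ω → ℝ) (t : ℕ∞) (Z : Ω → ℝ) :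
    Prop :=
  IsEssSup P (sigmaAt ℱ t)
    {f | ∃ ν : Ω → ℕ∞, IsStoppingTime ℱ ν ∧ (∀ ω, t ≤ ν ω) ∧
      f = P[fun ω => U (ν ω) ω | sigmaAt ℱ t]} Z

/-! ### The game -/

/-- The time `R = T_1 ∧ ⋯ ∧ T_N` at which the game terminates. -/
def endTime (T : Fin N → Ω → ℕ∞) (ω : Ω) : ℕ∞ := ⨅ j, T j ω

/-- The payoff `J_i(T_1, …, T_N)`: the sum over the nonempty coalitions `I` of `X^{i,I}_R` on the
event that `T_j = R` for `j ∈ I` and `T_j > R` for `j ∉ I`. -/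
def payoff (X : Fin N → Finset (Fin N) → ℕ∞ → Ω → ℝ) (i : Fin N) (T : Fin N → Ω → ℕ∞) (ω : Ω) :
    ℝ :=
  ∑ I : Finset (Fin N) with I.Nonempty,
    {ω' | (∀ j ∈ I, T j ω' = endTime T ω') ∧ ∀ j ∉ I, endTime T ω' < T j ω'}.indicator
      (fun ω' => X i I (endTime T ω') ω') ω

/-- `ε`-Nash equilibrium points in pure strategies (stopping times with values in `ℕ ∪ {∞}`). -/
structure IsNashEquilibrium (ℱ : Filtration ℕ mΩ) (P : Measure Ω)
    (X : Fin N → Finset (Fin N) → ℕ∞ → Ω → ℝ) (ε : ℝ) (T : Fin N → Ω → ℕ∞) : Prop where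
  isStoppingTime : ∀ i, IsStoppingTime ℱ (T i)
  le_add : ∀ i, ∀ S : Ω → ℕ∞, IsStoppingTime ℱ S →
    ∫ ω, payoff X i (Function.update T i S) ω ∂P ≤ ∫ ω, payoff X i T ω ∂P + ε

/-! ### The approximating scheme

Players and steps are numbered from `0`: the player who moves at step `n` is `n mod N`, and the
steps `0, …, N - 1` are the initial ones. -/

/-- The player who moves at step `n`. -/
def mover (N : ℕ) [NeZero N] (n : ℕ) : Fin N := Fin.ofNat N n

/-- `θ_n = min {τ_{n-1}, …, τ_{n-(N-1)}}`. -/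
def theta (N : ℕ) (τ : ℕ → Ω → ℕ∞) (n : ℕ) (ω : Ω) : ℕ∞ :=
  (Finset.Ico (n + 1 - N) n).inf fun l => τ l ω

/-- The coalition `I_n = {i_l : n - N + 1 ≤ l ≤ n - 1, τ_l = θ_n}`. -/
def coalition [NeZero N] (τ : ℕ → Ω → ℕ∞) (n : ℕ) (ω : Ω) : Finset (Fin N) :=
  {l ∈ Finset.Ico (n + 1 - N) n | τ l ω = theta N τ n ω}.image (mover N)

/-- The variable `Y^n`. -/
def rewardY [NeZero N] (X : Fin N → Finset (Fin N) → ℕ∞ → Ω → ℝ) (τ : ℕ → Ω → ℕ∞) (n : ℕ)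
    (ω : Ω) : ℝ :=
  if theta N τ n ω < ⊤ then
    max (X (mover N n) (coalition τ n ω ∪ {mover N n}) (theta N τ n ω) ω)
      (X (mover N n) (coalition τ n ω) (theta N τ n ω) ω)
  else X (mover N n) Finset.univ ⊤ ω

/-- The process `U^n`. -/
def rewardU [NeZero N] (X : Fin N → Finset (Fin N) → ℕ∞ → Ω → ℝ) (τ : ℕ → Ω → ℕ∞) (n : ℕ)
    (t : ℕ∞) (ω : Ω) : ℝ :=
  if t < theta N τ n ω then X (mover N n) {mover N n} t ω else rewardY X τ n ω

/-- `μ_n = min {s ∈ ℕ ∪ {∞} : W^n_s ≤ U^n_s + ε}`. -/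
def muTime [NeZero N] (X : Fin N → Finset (Fin N) → ℕ∞ → Ω → ℝ) (ε : ℝ) (τ : ℕ → Ω → ℕ∞)
    (W : ℕ → ℕ∞ → Ω → ℝ) (n : ℕ) (ω : Ω) : ℕ∞ :=
  sInf {s : ℕ∞ | W n s ω ≤ rewardU X τ n s ω + ε}

/-- `(τ_n)` is the sequence produced by the circular approximating scheme, with `W^n_t` the chosen
versions of the Snell envelopes (which are only determined almost surely). -/
structure IsApproxScheme [NeZero N] (ℱ : Filtration ℕ mΩ) (P : Measure Ω)
    (X : Fin N → Finset (Fin N) → ℕ∞ → Ω → ℝ) (ε : ℝ) (τ : ℕ → Ω → ℕ∞)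
    (W : ℕ → ℕ∞ → Ω → ℝ) : Prop where
  init : ∀ n < N, ∀ ω, τ n ω = ⊤
  snell : ∀ n, N ≤ n → ∀ t, IsSnellAt ℱ P (rewardU X τ n) t (W n t)
  step : ∀ n, N ≤ n → ∀ ω, τ n ω =
    if min (muTime X ε τ W n ω) (τ (n - N) ω) < theta N τ n ω then
      min (muTime X ε τ W n ω) (τ (n - N) ω)
    else τ (n - N) ω

end DynkinGame

end

noncomputable section

namespace DynkinGame

/-! ### Essential suprema, stopping times with values in ℕ ∪ {∞}, and Snell envelopes. -/

section EssentialSupremum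


variable {Ω : Type*} {mΩ : MeasurableSpace Ω}

/-! ### Essential suprema of dominated families -/

/-! At step `n` the mover faces fixed opponents, the first of whom stops at `theta`. Whatever
stopping time the mover plays, the payoff is at most `rewardU` stopped there
(`payoff_update_le_rewardU`), because at a finite `theta` the reward is the better of joining and
waiting. It remains to see that `τ n` is ε-optimal for this one-player problem and that it really
earns the reward.

The entry time of `W ≤ U + ε` is ε-optimal (`integral_stopped_le_entryTime`). No continuity at
infinity is needed: where the entry time is infinite, the tail suprema of `U` eventually equal `U
⊤`. The time `τ n` earns almost surely the same as the entry time (`ae_rewardU_eq`). Indeed, if the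
mover's previous time lies before `theta`, no opponent has changed times since that player's last
move, so the problem is locally the old one, and the previous time already satisfied `W ≤ U + ε`.

The payoff at `τ n` equals the reward (`rewardU_eq_payoff`) because two players never share a finite
time (`eq_top_of_eq`). A finite `theta` thus belongs to a single opponent `j`, and assumption (A)
says that joining `j` is no better than letting `j` stop alone.

So after each step the mover plays an ε-best response (`integral_payoff_update_le`). Non-increasing
sequences in ℕ ∪ {∞} are eventually constant, so at each point the profiles eventually coincide with
the limit profile, and dominated convergence carries the inequality over. -/

/-- Among suprema of countable subfamilies, one has maximal integral. Adjoining any further member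
cannot raise the integral, hence changes the supremum only on a null set. -/
theorem exists_isEssSup (P : Measure Ω) {m : MeasurableSpace Ω} (hm : m ≤ mΩ)
    {S : Set (Ω → ℝ)} (hne : S.Nonempty) (hmeas : ∀ f ∈ S, Measurable[m] f)
    {G : Ω → ℝ} (hG : Integrable G P) (hb : ∀ f ∈ S, ∀ᵐ ω ∂P, |f ω| ≤ G ω) :
    ∃ Z, IsEssSup P m S Z := by
  obtain ⟨f₀, hf₀⟩ := hne
  let s : (ℕ → S) → Ω → ℝ := fun φ ω => ⨆ n, (φ n : Ω → ℝ) ω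
  have hs_meas : ∀ φ, Measurable[m] (s φ) := fun φ =>
    Measurable.iSup fun n => hmeas _ (φ n).2
  have hs_bdd : ∀ φ : ℕ → S, ∀ᵐ ω ∂P, ∀ n, |(φ n : Ω → ℝ) ω| ≤ G ω := fun φ =>
    ae_all_iff.2 fun n => hb _ (φ n).2
  have bdd : ∀ (φ : ℕ → S) ω, (∀ n, |(φ n : Ω → ℝ) ω| ≤ G ω) →
      BddAbove (Set.range fun n => (φ n : Ω → ℝ) ω) := by
    rintro φ ω h
    exact ⟨G ω, by rintro _ ⟨n, rfl⟩; exact (abs_le.1 (h n)).2⟩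
  have hs_abs : ∀ φ, ∀ᵐ ω ∂P, |s φ ω| ≤ G ω := by
    intro φ
    filter_upwards [hs_bdd φ] with ω h
    refine abs_le.2 ⟨(abs_le.1 (h 0)).1.trans (le_ciSup (bdd φ ω h) 0), ciSup_le fun n => ?_⟩
    exact (abs_le.1 (h n)).2
  have hs_int : ∀ φ, Integrable (s φ) P := fun φ =>
    hG.mono' ((hs_meas φ).mono hm le_rfl).aestronglyMeasurable (hs_abs φ)
  have hs_mono : ∀ φ ψ : ℕ → S, (∀ n, ∃ k, ψ k = φ n) → s φ ≤ᵐ[P] s ψ := by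
    intro φ ψ h
    filter_upwards [hs_bdd ψ] with ω hψ
    refine ciSup_le fun n => ?_
    obtain ⟨k, hk⟩ := h n
    rw [← hk]
    exact le_ciSup (bdd ψ ω hψ) k
  let c : (ℕ → S) → ℝ := fun φ => ∫ ω, s φ ω ∂P
  have hc_bdd : BddAbove (Set.range c) := by
    refine ⟨∫ ω, G ω ∂P, ?_⟩
    rintro _ ⟨φ, rfl⟩
    refine integral_mono_ae (hs_int φ) hG ?_
    filter_upwards [hs_abs φ] with ω h using (abs_le.1 h).2
  obtain ⟨u, -, hu, hu_mem⟩ :=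
    exists_seq_tendsto_sSup (S := Set.range c) ⟨_, ⟨fun _ => ⟨f₀, hf₀⟩, rfl⟩⟩ hc_bdd
  choose φ hφ using hu_mem
  -- Pairing merges a maximising sequence of countable subfamilies into a single one.
  let ψ : ℕ → S := fun n => φ n.unpair.1 n.unpair.2
  have hψ : sSup (Set.range c) ≤ c ψ := by
    refine le_of_tendsto' hu fun k => ?_
    rw [← hφ k]
    refine integral_mono_ae (hs_int _) (hs_int _) (hs_mono _ _ fun n => ⟨Nat.pair k n, ?_⟩)
    simp [ψ]
  refine ⟨s ψ, hs_meas ψ, fun f hf => ?_, fun Z' _ hZ' => ?_⟩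
  · let χ : ℕ → S := fun n => Nat.casesOn n ⟨f, hf⟩ ψ
    have hle : s ψ ≤ᵐ[P] s χ := hs_mono _ _ fun n => ⟨n + 1, rfl⟩
    have heq : s ψ =ᵐ[P] s χ := by
      refine (integral_eq_iff_of_ae_le (hs_int _) (hs_int _) hle).1 (le_antisymm ?_ ?_)
      · exact integral_mono_ae (hs_int _) (hs_int _) hle
      · exact (le_csSup hc_bdd ⟨χ, rfl⟩).trans hψ
    filter_upwards [heq, hs_bdd χ] with ω h hχ
    rw [h]
    exact le_ciSup (bdd χ ω hχ) 0
  · have : ∀ᵐ ω ∂P, ∀ n, (ψ n : Ω → ℝ) ω ≤ Z' ω := ae_all_iff.2 fun n => hZ' _ (ψ n).2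
    filter_upwards [this] with ω h using ciSup_le h

/-! ### Measurability with respect to the filtration -/

theorem sigmaAt_le (ℱ : Filtration ℕ mΩ) (t : ℕ∞) : sigmaAt ℱ t ≤ mΩ := by
  cases t with
  | top => exact iSup_le ℱ.le
  | coe n => exact ℱ.le n

theorem sigmaAt_mono (ℱ : Filtration ℕ mΩ) : Monotone (sigmaAt ℱ) := by
  intro s t hst
  cases t with
  | top =>
    cases s with
    | top => exact le_rfl
    | coe n => exact le_iSup (fun n => (ℱ n : MeasurableSpace Ω)) n
  | coe k =>
    cases s with
    | top => simp at hst
    | coe n => exact ℱ.mono (by exact_mod_cast hst)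

theorem measurable_of_countable_selector {m : MeasurableSpace Ω} {ι : Type*} [Countable ι]
    {c : Ω → ι} {F : ι → Ω → ℝ} (hc : ∀ i, MeasurableSet[m] {ω | c ω = i})
    (hF : ∀ i, Measurable[m] (F i)) : Measurable[m] fun ω => F (c ω) ω := by
  intro s hs
  have : (fun ω => F (c ω) ω) ⁻¹' s = ⋃ i, {ω | c ω = i} ∩ F i ⁻¹' s := by
    ext ω; simp
  rw [this]
  exact MeasurableSet.iUnion fun i => (hc i).inter (hF i hs)

theorem measurable_of_measurableSet_le {m : MeasurableSpace Ω} {f : Ω → ℕ∞}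
    (h : ∀ s, MeasurableSet[m] {ω | f ω ≤ s}) : Measurable[m] f := by
  refine measurable_to_countable' fun s => ?_
  have : f ⁻¹' {s} = {ω | f ω ≤ s} \ ⋃ r : Set.Iio s, {ω | f ω ≤ r} := by
    ext ω
    simp only [Set.mem_preimage, Set.mem_singleton_iff, Set.mem_sdiff, Set.mem_ofPred_eq,
      Set.mem_iUnion, Subtype.exists, Set.mem_Iio, not_exists, not_le]
    refine ⟨fun h => ⟨h.le, fun r hr => h ▸ hr⟩, fun h => ?_⟩
    by_contra hne
    exact lt_irrefl _ (h.2 (f ω) (lt_of_le_of_ne h.1 hne))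
  rw [this]
  exact (h s).diff (MeasurableSet.iUnion fun r => h r)

/-- The cap `t + 1` keeps exactly what is known at time `t`: the value of `ν` if it is at most `t`,
and otherwise only that it is larger. -/
theorem measurable_min_stoppingTime {ℱ : Filtration ℕ mΩ} {ν : Ω → ℕ∞}
    (hν : IsStoppingTime ℱ ν) (t : ℕ∞) :
    Measurable[sigmaAt ℱ t] fun ω => min (ν ω) (t + 1) := by
  have hle : ∀ s : ℕ, (s : ℕ∞) ≤ t → MeasurableSet[sigmaAt ℱ t] {ω | ν ω ≤ (s : ℕ∞)} :=
    fun s hs => sigmaAt_mono ℱ hs _ (hν s)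
  refine measurable_of_measurableSet_le fun s => ?_
  by_cases hts : t + 1 ≤ s
  · convert MeasurableSet.univ
    ext ω; simp [hts]
  · have hst : s ≤ t := by
      cases s with
      | top => simp at hts
      | coe s =>
        cases t with
        | top => simp
        | coe t => norm_cast at hts ⊢; omega
    cases s with
    | top => simp at hts
    | coe s =>
      convert hle s hst using 1
      ext ω; simp [hts]

theorem measurable_stoppingTime {ℱ : Filtration ℕ mΩ} {ν : Ω → ℕ∞}
    (hν : IsStoppingTime ℱ ν) : Measurable[mΩ] ν := by
  simpa using (measurable_min_stoppingTime hν ⊤).mono (sigmaAt_le ℱ ⊤) le_rfl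

theorem measurableSet_stoppingTime_eq {ℱ : Filtration ℕ mΩ} {ν : Ω → ℕ∞}
    (hν : IsStoppingTime ℱ ν) (t : ℕ) : MeasurableSet[ℱ t] {ω | ν ω = t} :=
  hν.measurableSet_eq t

theorem measurableSet_lt_stoppingTime {ℱ : Filtration ℕ mΩ} {ν : Ω → ℕ∞}
    (hν : IsStoppingTime ℱ ν) (t : ℕ) : MeasurableSet[ℱ t] {ω | (t : ℕ∞) < ν ω} :=
  hν.measurableSet_gt t

theorem isStoppingTime_top (ℱ : Filtration ℕ mΩ) : IsStoppingTime ℱ fun _ : Ω => (⊤ : ℕ∞) := by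
  intro t
  exact @MeasurableSet.const _ (ℱ t) _

/-! ### Snell envelopes of dominated processes -/

/-- The process `U` is adapted on `ℕ ∪ {∞}` and dominated by the integrable variable `G`. -/
structure IsDominated (ℱ : Filtration ℕ mΩ) (P : Measure Ω) (U : ℕ∞ → Ω → ℝ) (G : Ω → ℝ) :
    Prop where
  measurable : ∀ t, Measurable[sigmaAt ℱ t] (U t)
  integrable : Integrable G P
  bound : ∀ᵐ ω ∂P, ∀ t, |U t ω| ≤ G ω

variable {ℱ : Filtration ℕ mΩ} {P : Measure Ω} {U V : ℕ∞ → Ω → ℝ} {G : Ω → ℝ}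

theorem IsDominated.integrable_stopped (hU : IsDominated ℱ P U G) {ν : Ω → ℕ∞}
    (hν : IsStoppingTime ℱ ν) : Integrable (fun ω => U (ν ω) ω) P := by
  refine hU.integrable.mono' (Measurable.aestronglyMeasurable ?_) ?_
  · refine measurable_of_countable_selector (fun t => ?_)
      fun t => (hU.measurable t).mono (sigmaAt_le ℱ t) le_rfl
    exact measurable_stoppingTime hν (measurableSet_singleton t)
  · filter_upwards [hU.bound] with ω h using h _

theorem IsDominated.integrable_apply (hU : IsDominated ℱ P U G) (t : ℕ∞) : Integrable (U t) P := by
  refine hU.integrable.mono'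
    ((hU.measurable t).mono (sigmaAt_le ℱ t) le_rfl).aestronglyMeasurable ?_
  filter_upwards [hU.bound] with ω h using h _

theorem abs_condExp_le {m : MeasurableSpace Ω} {f G : Ω → ℝ} (hf : Integrable f P)
    (hG : Integrable G P) (h : ∀ᵐ ω ∂P, |f ω| ≤ G ω) :
    ∀ᵐ ω ∂P, |(P[f | m]) ω| ≤ (P[G | m]) ω := by
  have h1 : P[f | m] ≤ᵐ[P] P[G | m] := condExp_mono hf hG (by
    filter_upwards [h] with ω h using (abs_le.1 h).2)
  have h2 : P[-G | m] ≤ᵐ[P] P[f | m] := condExp_mono hG.neg hf (by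
    filter_upwards [h] with ω h using (abs_le.1 h).1)
  filter_upwards [h1, h2, condExp_neg G m (μ := P)] with ω h1 h2 h3
  rw [h3] at h2
  exact abs_le.2 ⟨h2, h1⟩

theorem condExp_congr_on [IsFiniteMeasure P] {m : MeasurableSpace Ω} {f g : Ω → ℝ}
    (hf : Integrable f P) (hg : Integrable g P) {A : Set Ω} (hA : MeasurableSet[m] A)
    (h : ∀ ω ∈ A, f ω = g ω) : ∀ᵐ ω ∂P, ω ∈ A → (P[f | m]) ω = (P[g | m]) ω := by
  have heq : A.indicator f = A.indicator g := Set.indicator_congr h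
  have h1 := condExp_indicator hf hA
  rw [heq] at h1
  filter_upwards [h1, condExp_indicator hg hA] with ω h1 h2 hω
  rw [h1, Set.indicator_of_mem hω, Set.indicator_of_mem hω] at h2
  exact h2

theorem exists_isSnellAt (hU : IsDominated ℱ P U G) (t : ℕ∞) : ∃ Z, IsSnellAt ℱ P U t Z := by
  refine exists_isEssSup P (sigmaAt_le ℱ t) (G := P[G | sigmaAt ℱ t])
    ⟨_, fun _ => ⊤, isStoppingTime_top ℱ, fun _ => le_top, rfl⟩ ?_ integrable_condExp ?_
  · rintro _ ⟨ν, -, -, rfl⟩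
    exact stronglyMeasurable_condExp.measurable
  · rintro _ ⟨ν, hν, -, rfl⟩
    refine abs_condExp_le (hU.integrable_stopped hν) hU.integrable ?_
    filter_upwards [hU.bound] with ω h using h _

theorem IsSnellAt.le_condExp {t : ℕ∞} {Z g : Ω → ℝ} (hZ : IsSnellAt ℱ P U t Z)
    (hU : IsDominated ℱ P U G) (hg : Integrable g P)
    (h : ∀ᵐ ω ∂P, ∀ s, t ≤ s → U s ω ≤ g ω) : Z ≤ᵐ[P] P[g | sigmaAt ℱ t] := by
  refine hZ.least _ ((stronglyMeasurable_condExp.mono (sigmaAt_le ℱ t)).measurable) ?_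
  rintro _ ⟨ν, hν, htν, rfl⟩
  refine condExp_mono (hU.integrable_stopped hν) hg ?_
  filter_upwards [h] with ω h using h _ (htν ω)

theorem IsSnellAt.condExp_le {t : ℕ∞} {Z : Ω → ℝ} (hZ : IsSnellAt ℱ P U t Z)
    {ν : Ω → ℕ∞} (hν : IsStoppingTime ℱ ν) (htν : ∀ ω, t ≤ ν ω) :
    P[fun ω => U (ν ω) ω | sigmaAt ℱ t] ≤ᵐ[P] Z :=
  hZ.upper _ ⟨ν, hν, htν, rfl⟩

theorem IsSnellAt.integrable {t : ℕ∞} {Z : Ω → ℝ} (hZ : IsSnellAt ℱ P U t Z)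
    (hU : IsDominated ℱ P U G) : Integrable Z P := by
  have h1 : Z ≤ᵐ[P] P[G | sigmaAt ℱ t] := hZ.le_condExp hU hU.integrable (by
    filter_upwards [hU.bound] with ω h s _ using (abs_le.1 (h s)).2)
  have h2 := hZ.condExp_le (isStoppingTime_top ℱ) fun _ => le_top
  exact integrable_of_le_of_le (hZ.measurable.mono (sigmaAt_le ℱ t) le_rfl).aestronglyMeasurable
    h2 h1 integrable_condExp integrable_condExp

/-- Localised minimality: gluing `Z'` on `A` to `Z` off `A` gives an upper bound of the whole
family. -/
theorem IsSnellAt.le_on {t : ℕ∞} {Z Z' : Ω → ℝ} (hZ : IsSnellAt ℱ P U t Z)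
    {A : Set Ω} (hA : MeasurableSet[sigmaAt ℱ t] A) (hZ' : Measurable[mΩ] Z')
    (h : ∀ ν : Ω → ℕ∞, IsStoppingTime ℱ ν → (∀ ω, t ≤ ν ω) →
      ∀ᵐ ω ∂P, ω ∈ A → (P[fun ω => U (ν ω) ω | sigmaAt ℱ t]) ω ≤ Z' ω) :
    ∀ᵐ ω ∂P, ω ∈ A → Z ω ≤ Z' ω := by
  classical
  have key : Z ≤ᵐ[P] A.piecewise Z' Z := by
    refine hZ.least _ (Measurable.piecewise (sigmaAt_le ℱ t _ hA) hZ'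
      (hZ.measurable.mono (sigmaAt_le ℱ t) le_rfl)) ?_
    rintro _ ⟨ν, hν, htν, rfl⟩
    filter_upwards [h ν hν htν, hZ.condExp_le hν htν] with ω h1 h2
    by_cases hω : ω ∈ A
    · simpa [hω] using h1 hω
    · simpa [hω] using h2
  filter_upwards [key] with ω h hω
  simpa [hω] using h

/-- Snell envelopes are local. This lets envelopes from different steps of the scheme be compared on
the event where the rewards agree. -/
theorem IsSnellAt.le_of_eqOn [IsFiniteMeasure P] {G' : Ω → ℝ} {t : ℕ∞} {Z Z' : Ω → ℝ}
    (hU : IsDominated ℱ P U G) (hV : IsDominated ℱ P V G')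
    (hZ : IsSnellAt ℱ P U t Z) (hZ' : IsSnellAt ℱ P V t Z')
    {A : Set Ω} (hA : MeasurableSet[sigmaAt ℱ t] A) (h : ∀ ω ∈ A, ∀ s, U s ω = V s ω) :
    ∀ᵐ ω ∂P, ω ∈ A → Z ω ≤ Z' ω := by
  refine hZ.le_on hA (hZ'.measurable.mono (sigmaAt_le ℱ t) le_rfl) fun ν hν htν => ?_
  filter_upwards [hZ'.condExp_le hν htν, condExp_congr_on (hU.integrable_stopped hν)
    (hV.integrable_stopped hν) hA fun ω hω => h ω hω _] with ω h1 h2 hω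
  rw [h2 hω]
  exact h1

theorem IsSnellAt.le_self_on [IsFiniteMeasure P] {t : ℕ∞} {Z : Ω → ℝ}
    (hU : IsDominated ℱ P U G) (hZ : IsSnellAt ℱ P U t Z)
    {A : Set Ω} (hA : MeasurableSet[sigmaAt ℱ t] A) (h : ∀ ω ∈ A, ∀ s, t ≤ s → U s ω = U t ω) :
    ∀ᵐ ω ∂P, ω ∈ A → Z ω ≤ U t ω := by
  refine hZ.le_on hA ((hU.measurable t).mono (sigmaAt_le ℱ t) le_rfl) fun ν hν htν => ?_
  filter_upwards [condExp_congr_on (hU.integrable_stopped hν)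
    (hU.integrable_apply t) hA fun ω hω => h ω hω _ (htν ω)] with ω h2 hω
  rw [h2 hω, condExp_of_stronglyMeasurable (sigmaAt_le ℱ t) (hU.measurable t).stronglyMeasurable
    (hU.integrable_apply t)]

/-- Half of dynamic programming: splitting a competitor `ν` into `ν = t` and `ν > t` bounds the
envelope by the larger of `U t` and the conditional expectation of the next envelope. -/
theorem IsSnellAt.le_condExp_succ [IsFiniteMeasure P] {t : ℕ} {Z Z' : Ω → ℝ}
    (hU : IsDominated ℱ P U G) (hZ : IsSnellAt ℱ P U t Z)
    (hZ' : IsSnellAt ℱ P U (t + 1 : ℕ) Z') :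
    ∀ᵐ ω ∂P, U t ω < Z ω → Z ω ≤ (P[Z' | ℱ t]) ω := by
  have key : Z ≤ᵐ[P] fun ω => max (U t ω) ((P[Z' | ℱ t]) ω) := by
    refine hZ.least _ (Measurable.max ((hU.measurable t).mono (sigmaAt_le ℱ t) le_rfl)
      (stronglyMeasurable_condExp.mono (ℱ.le t)).measurable) ?_
    rintro _ ⟨ν, hν, htν, rfl⟩
    let ν' : Ω → ℕ∞ := fun ω => max (ν ω) (t + 1 : ℕ)
    have hν' : IsStoppingTime ℱ ν' := hν.max_const (t + 1)
    have h1 := condExp_congr_on (hU.integrable_stopped hν) (hU.integrable_apply t) (m := ℱ t)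
      (A := {ω | ν ω = t}) (measurableSet_stoppingTime_eq hν t) fun ω hω => by rw [hω]
    rw [condExp_of_stronglyMeasurable (ℱ.le t)
      (hU.measurable t).stronglyMeasurable (hU.integrable_apply t)] at h1
    have hsucc : ∀ ω, (t : ℕ∞) < ν ω → ν' ω = ν ω := by
      intro ω hω
      refine max_eq_left ?_
      push_cast
      exact Order.add_one_le_of_lt hω
    have h2 := condExp_congr_on (hU.integrable_stopped hν) (hU.integrable_stopped hν') (m := ℱ t)
      (A := {ω | (t : ℕ∞) < ν ω}) (measurableSet_lt_stoppingTime hν t)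
      fun ω hω => by rw [hsucc ω hω]
    have h3 : P[P[fun ω => U (ν' ω) ω | ℱ (t + 1)] | ℱ t] =ᵐ[P] P[fun ω => U (ν' ω) ω | ℱ t] :=
      condExp_condExp_of_le (ℱ.mono (Nat.le_succ t)) (ℱ.le (t + 1))
    have h4 : P[P[fun ω => U (ν' ω) ω | ℱ (t + 1)] | ℱ t] ≤ᵐ[P] P[Z' | ℱ t] :=
      condExp_mono integrable_condExp (hZ'.integrable hU)
        (hZ'.condExp_le hν' fun ω => le_max_right _ _)
    filter_upwards [h1, h2, h3, h4] with ω h1 h2 h3 h4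
    rcases (htν ω).eq_or_lt with h | h
    · exact (h1 h.symm).le.trans (le_max_left _ _)
    · refine le_trans ?_ (le_max_right _ _)
      refine (h2 h).le.trans ?_
      rw [← h3]; exact h4
  filter_upwards [key] with ω h hlt
  exact (le_max_iff.1 h).resolve_left (not_le.2 hlt)

end EssentialSupremum

/-! ### Optimal stopping for one player. -/

section OptimalStopping


variable {Ω : Type*} {mΩ : MeasurableSpace Ω}
variable {ℱ : Filtration ℕ mΩ} {P : Measure Ω} {U : ℕ∞ → Ω → ℝ} {G : Ω → ℝ}

/-! ### Optimality of the `ε`-entry time -/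

/-- The first time at which `W ≤ U + ε`. -/
def entryTime (U W : ℕ∞ → Ω → ℝ) (ε : ℝ) (ω : Ω) : ℕ∞ := sInf {s : ℕ∞ | W s ω ≤ U s ω + ε}

theorem entryTime_le {W : ℕ∞ → Ω → ℝ} {ε : ℝ} {ω : Ω} {s : ℕ∞} (h : W s ω ≤ U s ω + ε) :
    entryTime U W ε ω ≤ s := sInf_le h

theorem lt_of_lt_entryTime {W : ℕ∞ → Ω → ℝ} {ε : ℝ} {ω : Ω} {s : ℕ∞}
    (h : s < entryTime U W ε ω) : U s ω + ε < W s ω :=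
  not_le.1 fun h' => not_le.2 h (entryTime_le h')

theorem entryTime_mem {W : ℕ∞ → Ω → ℝ} {ε : ℝ} {ω : Ω} {s : ℕ∞}
    (h : entryTime U W ε ω = s) (hs : s < ⊤) : W s ω ≤ U s ω + ε := by
  subst h
  have hne : {s : ℕ∞ | W s ω ≤ U s ω + ε}.Nonempty := by
    by_contra hne
    rw [Set.not_nonempty_iff_eq_empty] at hne
    simp [entryTime, hne] at hs
  exact csInf_mem hne

theorem isStoppingTime_entryTime {W : ℕ∞ → Ω → ℝ} (hU : ∀ t, Measurable[sigmaAt ℱ t] (U t))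
    (hW : ∀ t, Measurable[sigmaAt ℱ t] (W t)) (ε : ℝ) : IsStoppingTime ℱ (entryTime U W ε) := by
  intro t
  have : {ω | entryTime U W ε ω ≤ (t : ℕ∞)} =
      ⋃ s : Set.Iic (t : ℕ∞), {ω | W s ω ≤ U s ω + ε} := by
    ext ω
    simp only [Set.mem_ofPred_eq, Set.mem_iUnion, Subtype.exists, Set.mem_Iic]
    constructor
    · intro h
      exact ⟨_, h, entryTime_mem rfl (h.trans_lt (ENat.natCast_lt_top t))⟩
    · rintro ⟨s, hs, h⟩
      exact (entryTime_le h).trans hs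
  change MeasurableSet[ℱ t] {ω | entryTime U W ε ω ≤ (t : ℕ∞)}
  rw [this]
  refine MeasurableSet.iUnion fun s => ?_
  have hle : sigmaAt ℱ s ≤ ℱ t := sigmaAt_mono ℱ (show (s : ℕ∞) ≤ (t : ℕ∞) from s.2)
  exact measurableSet_le ((hW s).mono hle le_rfl) (((hU s).mono hle le_rfl).add_const ε)

/-- The supremum of `U s` over `s ≥ k`. -/
def tailSup (U : ℕ∞ → Ω → ℝ) (k : ℕ) (ω : Ω) : ℝ := ⨆ s : ℕ∞, U (max k s) ω

theorem bddAbove_tail {ω : Ω} (h : ∀ t, |U t ω| ≤ G ω) (k : ℕ) :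
    BddAbove (Set.range fun s : ℕ∞ => U (max k s) ω) :=
  ⟨G ω, by rintro _ ⟨s, rfl⟩; exact (abs_le.1 (h _)).2⟩

theorem le_tailSup {ω : Ω} (h : ∀ t, |U t ω| ≤ G ω) {k : ℕ} {s : ℕ∞} (hs : k ≤ s) :
    U s ω ≤ tailSup U k ω := by
  have := le_ciSup (bddAbove_tail h k) s
  rwa [max_eq_right hs] at this

theorem tailSup_le {ω : Ω} {k : ℕ} {a : ℝ} (h : ∀ s : ℕ∞, k ≤ s → U s ω ≤ a) :
    tailSup U k ω ≤ a := ciSup_le fun _ => h _ (le_max_left _ _)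

theorem abs_tailSup_le {ω : Ω} (h : ∀ t, |U t ω| ≤ G ω) (k : ℕ) : |tailSup U k ω| ≤ G ω :=
  abs_le.2 ⟨(abs_le.1 (h k)).1.trans (le_tailSup h le_rfl),
    tailSup_le fun s _ => (abs_le.1 (h s)).2⟩

theorem tailSup_anti {ω : Ω} (h : ∀ t, |U t ω| ≤ G ω) : Antitone fun k => tailSup U k ω :=
  fun _ _ hkl => tailSup_le fun _ hs => le_tailSup h (le_trans (by exact_mod_cast hkl) hs)

theorem IsDominated.measurable_tailSup (hU : IsDominated ℱ P U G) (k : ℕ) :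
    Measurable[sigmaAt ℱ ⊤] (tailSup U k) :=
  Measurable.iSup fun _ => (hU.measurable _).mono (sigmaAt_mono ℱ le_top) le_rfl

theorem IsDominated.integrable_tailSup (hU : IsDominated ℱ P U G) (k : ℕ) :
    Integrable (tailSup U k) P := by
  refine hU.integrable.mono'
    ((hU.measurable_tailSup k).mono (sigmaAt_le ℱ ⊤) le_rfl).aestronglyMeasurable ?_
  filter_upwards [hU.bound] with ω h using abs_tailSup_le h k

theorem IsSnellAt.le_condExp_tailSup {t : ℕ∞} {Z : Ω → ℝ} {k : ℕ} (hkt : k ≤ t)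
    (hU : IsDominated ℱ P U G) (hZ : IsSnellAt ℱ P U t Z) :
    Z ≤ᵐ[P] P[tailSup U k | sigmaAt ℱ t] := by
  refine hZ.le_condExp hU (hU.integrable_tailSup k) ?_
  filter_upwards [hU.bound] with ω h s hs using le_tailSup h (hkt.trans hs)

/-- Let `ℓ` be the limit of the tail suprema. Eventually `w t < ℓ + ε / 2`, so `U t` stays below `ℓ`
by a fixed margin at late finite times. Since tail suprema are at least `ℓ`, only time `⊤` can
account for them. -/
theorem eventually_tailSup_eq_of_forall_lt {ω : Ω} {w : ℕ → ℝ} {ε : ℝ} (hε : 0 < ε)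
    (hG : ∀ t, |U t ω| ≤ G ω) (hw : ∀ t : ℕ, U t ω + ε < w t)
    (hlim : ∀ k : ℕ, ∀ δ > 0, ∀ᶠ t in atTop, w t < tailSup U k ω + δ) :
    ∀ᶠ k in atTop, tailSup U k ω = U ⊤ ω := by
  have hbdd : BddBelow (Set.range fun k => tailSup U k ω) :=
    ⟨-G ω, by rintro _ ⟨k, rfl⟩; exact (abs_le.1 (abs_tailSup_le hG k)).1⟩
  set ℓ := ⨅ k, tailSup U k ω with hℓ
  obtain ⟨k, hk⟩ := exists_lt_of_ciInf_lt (show ℓ < ℓ + ε / 4 by linarith)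
  obtain ⟨t₀, ht₀⟩ := eventually_atTop.1 (hlim k (ε / 4) (by linarith))
  have hsmall : ∀ t : ℕ, t₀ ≤ t → U t ω < ℓ - ε / 4 := fun t ht => by
    have h1 := ht₀ t ht
    have h2 := hw t
    linarith
  have hmax : tailSup U t₀ ω ≤ max (ℓ - ε / 4) (U ⊤ ω) := by
    refine tailSup_le fun s hs => ?_
    cases s with
    | top => exact le_max_right _ _
    | coe s => exact (hsmall s (by exact_mod_cast hs)).le.trans (le_max_left _ _)
  have htop : tailSup U t₀ ω ≤ U ⊤ ω := by
    refine (le_max_iff.1 hmax).resolve_left (not_le.2 ?_)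
    have : ℓ ≤ tailSup U t₀ ω := ciInf_le hbdd t₀
    linarith
  filter_upwards [eventually_ge_atTop t₀] with t ht
  exact le_antisymm ((tailSup_anti hG ht).trans htop) (le_tailSup hG le_top)

section Optimality

variable {W : ℕ∞ → Ω → ℝ} {ε : ℝ}

/-- The reward collected at the entry time if it is before `t`, and `Z` otherwise. -/
def cutReward (U W : ℕ∞ → Ω → ℝ) (ε : ℝ) (t : ℕ) (Z : Ω → ℝ) (ω : Ω) : ℝ :=
  if entryTime U W ε ω < t then U (entryTime U W ε ω) ω + ε else Z ω

theorem isStoppingTime_entryTime_of_isSnellAt (hU : IsDominated ℱ P U G)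
    (hW : ∀ t, IsSnellAt ℱ P U t (W t)) : IsStoppingTime ℱ (entryTime U W ε) :=
  isStoppingTime_entryTime hU.measurable (fun t => (hW t).measurable) ε

theorem integrable_cutReward [IsFiniteMeasure P] (hU : IsDominated ℱ P U G)
    (hW : ∀ t, IsSnellAt ℱ P U t (W t)) (t : ℕ) {Z : Ω → ℝ} (hZ : Integrable Z P) :
    Integrable (cutReward U W ε t Z) P := by
  classical
  have hμ := isStoppingTime_entryTime_of_isSnellAt (ε := ε) hU hW
  have heq : cutReward U W ε t Z = {ω | entryTime U W ε ω < t}.piecewise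
      (fun ω => U (entryTime U W ε ω) ω + ε) Z := by
    ext ω; simp [cutReward, Set.piecewise]
  rw [heq]
  exact Integrable.piecewise
    (measurable_stoppingTime hμ (MeasurableSet.of_discrete (s := Set.Iio (t : ℕ∞))))
    ((hU.integrable_stopped hμ).add (integrable_const ε)).integrableOn hZ.integrableOn

theorem integral_le_of_forall_mem_le_of_setIntegral_le {f g : Ω → ℝ} {A : Set Ω}
    (hA : MeasurableSet A) (hf : Integrable f P) (hg : Integrable g P)
    (h : ∀ ω ∈ Aᶜ, f ω ≤ g ω) (hint : ∫ ω in A, f ω ∂P ≤ ∫ ω in A, g ω ∂P) :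
    ∫ ω, f ω ∂P ≤ ∫ ω, g ω ∂P := by
  rw [← integral_add_compl hA hf, ← integral_add_compl hA hg]
  exact add_le_add hint (setIntegral_mono_on hf.integrableOn hg.integrableOn hA.compl h)

/-- Before the entry time `W` exceeds `U`, so the envelope there is a submartingale; at the entry
time it is replaced by the larger `U + ε`. -/
theorem integral_cutReward_succ [IsFiniteMeasure P] (hε : 0 ≤ ε) (hU : IsDominated ℱ P U G)
    (hW : ∀ t, IsSnellAt ℱ P U t (W t)) (t : ℕ) :
    ∫ ω, cutReward U W ε t (W t) ω ∂P ≤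
      ∫ ω, cutReward U W ε (t + 1) (W (t + 1 : ℕ)) ω ∂P := by
  have hμ := isStoppingTime_entryTime_of_isSnellAt (ε := ε) hU hW
  have hA := measurableSet_lt_stoppingTime hμ t
  refine integral_le_of_forall_mem_le_of_setIntegral_le (ℱ.le t _ hA)
    (integrable_cutReward hU hW t ((hW t).integrable hU))
    (integrable_cutReward hU hW (t + 1) ((hW _).integrable hU)) ?_ ?_
  · intro ω hω
    have hle : entryTime U W ε ω ≤ t := not_lt.1 hω
    have hlt : entryTime U W ε ω < ((t + 1 : ℕ) : ℕ∞) :=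
      hle.trans_lt (by exact_mod_cast Nat.lt_succ_self t)
    simp only [cutReward, if_pos hlt]
    split_ifs with h
    · exact le_rfl
    · have heq : entryTime U W ε ω = t := le_antisymm hle (not_lt.1 h)
      rw [heq]
      exact entryTime_mem heq (ENat.natCast_lt_top t)
  · have h1 : ∫ ω in {ω | (t : ℕ∞) < entryTime U W ε ω}, cutReward U W ε t (W t) ω ∂P =
        ∫ ω in {ω | (t : ℕ∞) < entryTime U W ε ω}, W t ω ∂P :=
      setIntegral_congr_fun (ℱ.le t _ hA) fun ω hω => if_neg (not_lt.2 (le_of_lt hω))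
    have h2 : ∫ ω in {ω | (t : ℕ∞) < entryTime U W ε ω},
        cutReward U W ε (t + 1) (W (t + 1 : ℕ)) ω ∂P =
        ∫ ω in {ω | (t : ℕ∞) < entryTime U W ε ω}, W (t + 1 : ℕ) ω ∂P := by
      refine setIntegral_congr_fun (ℱ.le t _ hA) fun ω hω => if_neg (not_lt.2 ?_)
      push_cast
      exact Order.add_one_le_of_lt hω
    rw [h1, h2, ← setIntegral_condExp (ℱ.le t) ((hW (t + 1 : ℕ)).integrable hU) hA]
    refine setIntegral_mono_on_ae ((hW t).integrable hU).integrableOn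
      integrable_condExp.integrableOn (ℱ.le t _ hA) ?_
    filter_upwards [IsSnellAt.le_condExp_succ hU (hW t) (hW (t + 1 : ℕ))] with ω h hω
    have := lt_of_lt_entryTime hω
    exact h (by linarith)

/-- Trading `W t` for `tailSup U t` leaves a quantity whose pathwise limit in `t` can be identified.
-/
theorem integral_snell_zero_le [IsFiniteMeasure P] (hε : 0 ≤ ε) (hU : IsDominated ℱ P U G)
    (hW : ∀ t, IsSnellAt ℱ P U t (W t)) (t : ℕ) :
    ∫ ω, W (0 : ℕ) ω ∂P ≤ ∫ ω, cutReward U W ε t (tailSup U t) ω ∂P := by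
  have h1 : ∫ ω, W (0 : ℕ) ω ∂P ≤ ∫ ω, cutReward U W ε t (W t) ω ∂P := by
    induction t with
    | zero =>
      refine le_of_eq (integral_congr_ae (ae_of_all _ fun ω => ?_))
      simp [cutReward]
    | succ t ih => exact ih.trans (integral_cutReward_succ hε hU hW t)
  refine h1.trans ?_
  have hμ := isStoppingTime_entryTime_of_isSnellAt (ε := ε) hU hW
  have hA : MeasurableSet[ℱ t] {ω | (t : ℕ∞) ≤ entryTime U W ε ω} := hμ.measurableSet_ge t
  refine integral_le_of_forall_mem_le_of_setIntegral_le (ℱ.le t _ hA)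
    (integrable_cutReward hU hW t ((hW t).integrable hU))
    (integrable_cutReward hU hW t (hU.integrable_tailSup t)) ?_ ?_
  · intro ω hω
    have hlt : entryTime U W ε ω < t := not_le.1 hω
    simp [cutReward, hlt]
  · have h : ∀ Z : Ω → ℝ, ∫ ω in {ω | (t : ℕ∞) ≤ entryTime U W ε ω}, cutReward U W ε t Z ω ∂P =
        ∫ ω in {ω | (t : ℕ∞) ≤ entryTime U W ε ω}, Z ω ∂P := fun Z =>
      setIntegral_congr_fun (ℱ.le t _ hA) fun ω hω => if_neg (not_lt.2 hω)
    rw [h, h, ← setIntegral_condExp (ℱ.le t) (hU.integrable_tailSup t) hA]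
    exact setIntegral_mono_ae ((hW t).integrable hU).integrableOn
      integrable_condExp.integrableOn (IsSnellAt.le_condExp_tailSup le_rfl hU (hW t))

/-- For fixed `k`, the envelope is dominated by the martingale closed by `tailSup U k`, which
converges to `tailSup U k` by Lévy's upward theorem. -/
theorem ae_eventually_tailSup_eq [IsFiniteMeasure P] (hε : 0 < ε) (hU : IsDominated ℱ P U G)
    (hW : ∀ t, IsSnellAt ℱ P U t (W t)) :
    ∀ᵐ ω ∂P, entryTime U W ε ω = ⊤ → ∀ᶠ k in atTop, tailSup U k ω = U ⊤ ω := by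
  have h1 : ∀ᵐ ω ∂P, ∀ k t : ℕ, k ≤ t → W t ω ≤ (P[tailSup U k | ℱ t]) ω := by
    refine ae_all_iff.2 fun k => ae_all_iff.2 fun t => ?_
    by_cases hkt : k ≤ t
    · filter_upwards [IsSnellAt.le_condExp_tailSup (k := k) (by exact_mod_cast hkt) hU (hW t)]
        with ω h _ using h
    · simp [hkt]
  have h2 : ∀ᵐ ω ∂P, ∀ k : ℕ,
      Tendsto (fun t => (P[tailSup U k | ℱ t]) ω) atTop (𝓝 (tailSup U k ω)) :=
    ae_all_iff.2 fun k => (hU.integrable_tailSup k).tendsto_ae_condExp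
      (hU.measurable_tailSup k).stronglyMeasurable
  filter_upwards [h1, h2, hU.bound] with ω h1 h2 h3 hω
  refine eventually_tailSup_eq_of_forall_lt hε h3 (w := fun t => W t ω)
    (fun t => lt_of_lt_entryTime (by rw [hω]; exact ENat.natCast_lt_top t)) fun k δ hδ => ?_
  filter_upwards [eventually_ge_atTop k, (h2 k).eventually_lt_const
    (show tailSup U k ω < tailSup U k ω + δ by linarith)] with t ht hlt
  exact (h1 k t ht).trans_lt hlt

theorem integral_stopped_le_entryTime [IsProbabilityMeasure P] (hε : 0 < ε)
    (hU : IsDominated ℱ P U G) (hW : ∀ t, IsSnellAt ℱ P U t (W t))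
    {S : Ω → ℕ∞} (hS : IsStoppingTime ℱ S) :
    ∫ ω, U (S ω) ω ∂P ≤ ∫ ω, U (entryTime U W ε ω) ω ∂P + ε := by
  have hμ := isStoppingTime_entryTime_of_isSnellAt (ε := ε) hU hW
  have h0 : ∫ ω, U (S ω) ω ∂P ≤ ∫ ω, W (0 : ℕ) ω ∂P := by
    rw [← integral_condExp (ℱ.le 0)]
    exact integral_mono_ae integrable_condExp ((hW _).integrable hU)
      ((hW (0 : ℕ)).condExp_le hS fun ω => by simp)
  refine h0.trans ?_
  -- No `ε` is added where the entry time is infinite: there the tail suprema reach `U ⊤` itself.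
  let lim : Ω → ℝ := fun ω => if entryTime U W ε ω < ⊤ then U (entryTime U W ε ω) ω + ε
    else U (entryTime U W ε ω) ω
  have hlim : Tendsto (fun t : ℕ => ∫ ω, cutReward U W ε t (tailSup U t) ω ∂P) atTop
      (𝓝 (∫ ω, lim ω ∂P)) := by
    refine tendsto_integral_of_dominated_convergence (fun ω => G ω + ε)
      (fun t => (integrable_cutReward hU hW t (hU.integrable_tailSup t)).aestronglyMeasurable)
      (hU.integrable.add (integrable_const ε)) (fun t => ?_) ?_
    · filter_upwards [hU.bound] with ω h
      rw [Real.norm_eq_abs, cutReward]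
      split_ifs
      · exact (abs_add_le _ _).trans (add_le_add (h _) (abs_of_pos hε).le)
      · exact (abs_tailSup_le h t).trans (by linarith)
    · filter_upwards [ae_eventually_tailSup_eq hε hU hW] with ω h
      refine tendsto_const_nhds.congr' ?_
      by_cases hω : entryTime U W ε ω = ⊤
      · filter_upwards [h hω] with t ht
        simp [lim, cutReward, hω, ht]
      · obtain ⟨s, hs⟩ := ENat.ne_top_iff_exists.1 hω
        filter_upwards [eventually_gt_atTop s] with t ht
        simp [lim, cutReward, ← hs, ht]
  refine (ge_of_tendsto' hlim (integral_snell_zero_le hε.le hU hW)).trans ?_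
  have hadd : ∫ ω, (U (entryTime U W ε ω) ω + ε) ∂P = ∫ ω, U (entryTime U W ε ω) ω ∂P + ε := by
    rw [integral_add (hU.integrable_stopped hμ) (integrable_const ε)]
    simp
  rw [← hadd]
  have hint : Integrable lim P := by
    classical
    have heq : lim = {ω | entryTime U W ε ω < ⊤}.piecewise
        (fun ω => U (entryTime U W ε ω) ω + ε) fun ω => U (entryTime U W ε ω) ω := by
      ext ω; simp [lim, Set.piecewise]
    rw [heq]
    exact Integrable.piecewise
      (measurable_stoppingTime hμ (MeasurableSet.of_discrete (s := Set.Iio (⊤ : ℕ∞))))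
      ((hU.integrable_stopped hμ).add (integrable_const ε)).integrableOn
      (hU.integrable_stopped hμ).integrableOn
  refine integral_mono hint ((hU.integrable_stopped hμ).add (integrable_const ε)) fun ω => ?_
  simp only [lim]
  split_ifs <;> linarith

end Optimality

end OptimalStopping

/-! ### The scheme: pathwise structure, measurability and existence. -/

section Scheme


variable {Ω : Type*} {mΩ : MeasurableSpace Ω} {N : ℕ} [NeZero N]
variable {ℱ : Filtration ℕ mΩ} {P : Measure Ω} {X : Fin N → Finset (Fin N) → ℕ∞ → Ω → ℝ}
  {ε : ℝ} {τ : ℕ → Ω → ℕ∞} {W : ℕ → ℕ∞ → Ω → ℝ} {G : Ω → ℝ}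

set_option linter.unusedSectionVars false

/-! ### Pathwise properties of the scheme -/

theorem theta_le {n l : ℕ} (h₁ : n < l + N) (h₂ : l < n) (ω : Ω) : theta N τ n ω ≤ τ l ω :=
  Finset.inf_le (Finset.mem_Ico.2 ⟨by omega, h₂⟩)

theorem exists_theta_eq (hN : 2 ≤ N) {n : ℕ} (hn : 0 < n) (τ : ℕ → Ω → ℕ∞) (ω : Ω) :
    ∃ l, n < l + N ∧ l < n ∧ τ l ω = theta N τ n ω := by
  have hne : (Finset.Ico (n + 1 - N) n).Nonempty := Finset.nonempty_Ico.2 (by omega)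
  obtain ⟨l, hl, h⟩ := Finset.exists_mem_eq_inf _ hne fun l => τ l ω
  rw [Finset.mem_Ico] at hl
  exact ⟨l, by omega, hl.2, h.symm⟩

theorem mem_coalition {n : ℕ} {ω : Ω} {j : Fin N} : j ∈ coalition τ n ω ↔
    ∃ l, n < l + N ∧ l < n ∧ τ l ω = theta N τ n ω ∧ mover N l = j := by
  simp only [coalition, Finset.mem_image, Finset.mem_filter, Finset.mem_Ico]
  refine exists_congr fun l => ⟨fun h => ⟨by omega, h.1.1.2, h.1.2, h.2⟩,
    fun h => ⟨⟨⟨by omega, h.2.1⟩, h.2.2.1⟩, h.2.2.2⟩⟩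

theorem coalition_nonempty (hN : 2 ≤ N) {n : ℕ} (hn : 0 < n) (τ : ℕ → Ω → ℕ∞) (ω : Ω) :
    (coalition (N := N) τ n ω).Nonempty := by
  obtain ⟨l, h1, h2, h3⟩ := exists_theta_eq hN hn τ ω
  exact ⟨_, mem_coalition.2 ⟨l, h1, h2, h3, rfl⟩⟩

theorem mover_add (N : ℕ) [NeZero N] (n : ℕ) : mover N (n + N) = mover N n := by
  ext; simp [mover, Fin.ofNat]

theorem mover_injOn {l k : ℕ} (hlk : l < k) (hk : k < l + N) : mover N l ≠ mover N k := by
  intro h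
  have h' : l % N = k % N := congrArg Fin.val h
  have h2 : (k - l) % N = 0 := Nat.sub_mod_eq_zero_of_mod_eq h'.symm
  rw [Nat.mod_eq_of_lt (by omega)] at h2
  omega

section Pathwise

variable (hτ : IsApproxScheme ℱ P X ε τ W)

include hτ

theorem IsApproxScheme.le_sub {n : ℕ} (hn : N ≤ n) (ω : Ω) : τ n ω ≤ τ (n - N) ω := by
  rw [hτ.step n hn ω]
  split_ifs
  · exact min_le_right _ _
  · exact le_rfl

theorem IsApproxScheme.eq_sub_or_lt {n : ℕ} (hn : N ≤ n) (ω : Ω) :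
    τ n ω = τ (n - N) ω ∨ τ n ω < theta N τ n ω := by
  rw [hτ.step n hn ω]
  split_ifs with h
  · exact Or.inr h
  · exact Or.inl rfl

/-- A time that changes becomes strictly smaller than all current times of the opponents, so a tie
can only be inherited, ultimately from the initial value `⊤`. -/
theorem IsApproxScheme.eq_top_of_eq {l k : ℕ} (hlk : l < k) (hkl : k < l + N) {ω : Ω}
    (h : τ l ω = τ k ω) : τ k ω = ⊤ := by
  induction k using Nat.strong_induction_on generalizing l with
  | _ k ih =>
    by_cases hk : k < N
    · exact hτ.init k hk ω
    · rcases hτ.eq_sub_or_lt (not_lt.1 hk) ω with h' | h'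
      · rw [← h]
        -- The roles swap: the tie is now between `k - N` and the later step `l`, again less than
        -- `N` apart.
        exact ih l hlk (l := k - N) (by omega) (by omega) (by rw [h, h'])
      · exact absurd (h'.trans_le (theta_le hkl hlk ω)) (by rw [h]; exact lt_irrefl _)

/-- An opponent changing at `k` would move strictly below `τ (n - N)`, which is still in the window
of `k`; but `theta` at `n` is at most that new time and exceeds `τ (n - N)`. -/
theorem IsApproxScheme.eq_sub_of_lt_theta {n : ℕ} (hn : N ≤ n) {ω : Ω}
    (h : τ (n - N) ω < theta N τ n ω) :
    2 * N ≤ n ∧ ∀ k, n - N < k → k < n → τ k ω = τ (k - N) ω := by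
  have h2 : 2 * N ≤ n := by
    by_contra hlt
    rw [hτ.init (n - N) (by omega) ω] at h
    exact not_top_lt h
  refine ⟨h2, fun k hk1 hk2 => ?_⟩
  refine (hτ.eq_sub_or_lt (by omega) ω).resolve_right fun hk => ?_
  have h3 : theta N τ k ω ≤ τ (n - N) ω := theta_le (by omega) hk1 ω
  have h4 : theta N τ n ω ≤ τ k ω := theta_le (by omega) hk2 ω
  exact lt_irrefl _ (h.trans_le (h4.trans (hk.le.trans h3)))

end Pathwise

theorem theta_congr {τ' : ℕ → Ω → ℕ∞} {n : ℕ} {ω : Ω}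
    (h : ∀ k < n, τ k ω = τ' k ω) : theta N τ n ω = theta N τ' n ω :=
  Finset.inf_congr rfl fun k hk => h k (Finset.mem_Ico.1 hk).2

theorem rewardU_eq_of_theta_coalition {τ' : ℕ → Ω → ℕ∞} {n k : ℕ} {ω : Ω}
    (hm : mover N n = mover N k) (hθ : theta N τ n ω = theta N τ' k ω)
    (hc : coalition (N := N) τ n ω = coalition τ' k ω) (t : ℕ∞) :
    rewardU X τ n t ω = rewardU X τ' k t ω := by
  simp only [rewardU, rewardY, hm, hθ, hc]

theorem rewardU_congr {τ' : ℕ → Ω → ℕ∞} {n : ℕ} {ω : Ω} (h : ∀ k < n, τ k ω = τ' k ω) (t : ℕ∞) :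
    rewardU X τ n t ω = rewardU X τ' n t ω := by
  refine rewardU_eq_of_theta_coalition rfl (theta_congr h) ?_ t
  simp only [coalition, theta_congr h]
  congr 1
  exact Finset.filter_congr fun k hk => by rw [h k (Finset.mem_Ico.1 hk).2]

theorem IsApproxScheme.rewardU_eq_sub (hτ : IsApproxScheme ℱ P X ε τ W) (hN : 2 ≤ N) {n : ℕ}
    (hn : N ≤ n) {ω : Ω} (h : τ (n - N) ω < theta N τ n ω) :
    theta N τ n ω = theta N τ (n - N) ω ∧ ∀ t, rewardU X τ n t ω = rewardU X τ (n - N) t ω := by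
  obtain ⟨h2, hk⟩ := hτ.eq_sub_of_lt_theta hn h
  have hθ : theta N τ n ω = theta N τ (n - N) ω := by
    refine le_antisymm ?_ ?_
    · obtain ⟨l, h3, h4, h5⟩ := exists_theta_eq hN (show 0 < n - N by omega) τ ω
      have := hk (l + N) (by omega) (by omega)
      rw [Nat.add_sub_cancel] at this
      rw [← h5, ← this]
      exact theta_le (by omega) (by omega) ω
    · obtain ⟨l, h3, h4, h5⟩ := exists_theta_eq hN (show 0 < n by omega) τ ω
      rw [← h5, hk l (by omega) h4]
      exact theta_le (by omega) (by omega) ω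
  refine ⟨hθ, rewardU_eq_of_theta_coalition ?_ hθ ?_⟩
  · conv_lhs => rw [← Nat.sub_add_cancel hn]
    exact mover_add N _
  · ext j
    rw [mem_coalition, mem_coalition]
    constructor
    · rintro ⟨l, h3, h4, h5, h6⟩
      refine ⟨l - N, by omega, by omega, by rw [← hk l (by omega) h4, h5, hθ], ?_⟩
      rw [← h6]
      conv_rhs => rw [← Nat.sub_add_cancel (show N ≤ l by omega)]
      exact (mover_add N _).symm
    · rintro ⟨l, h3, h4, h5, h6⟩
      refine ⟨l + N, by omega, by omega, ?_, by rw [mover_add, h6]⟩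
      rw [hk (l + N) (by omega) (by omega), Nat.add_sub_cancel, h5, hθ]

theorem rewardU_of_theta_le {n : ℕ} {t : ℕ∞} {ω : Ω} (h : theta N τ n ω ≤ t) :
    rewardU X τ n t ω = rewardY X τ n ω := if_neg (not_lt.2 h)

/-! ### Measurability and domination along the scheme -/

theorem isStoppingTime_theta {n : ℕ} (h : ∀ l < n, IsStoppingTime ℱ (τ l)) :
    IsStoppingTime ℱ (theta N τ n) := by
  intro t
  have : {ω | theta N τ n ω ≤ (t : ℕ∞)} =
      ⋃ l ∈ Finset.Ico (n + 1 - N) n, {ω | τ l ω ≤ (t : ℕ∞)} := by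
    ext ω
    simp [theta, Finset.inf_le_iff (ENat.natCast_lt_top t)]
  change MeasurableSet[ℱ t] {ω | theta N τ n ω ≤ (t : ℕ∞)}
  rw [this]
  exact Finset.measurableSet_biUnion _ fun l hl => h l (Finset.mem_Ico.1 hl).2 t

/-- If `σ ≤ t`, the comparison with `θ` is decided by time `t`; if `σ > t`, then `ρ > t` too, and
the choice is irrelevant. -/
theorem isStoppingTime_ite {σ θ ρ : Ω → ℕ∞} (hσ : IsStoppingTime ℱ σ) (hθ : IsStoppingTime ℱ θ)
    (hρ : IsStoppingTime ℱ ρ) (h : ∀ ω, σ ω ≤ ρ ω) :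
    IsStoppingTime ℱ fun ω => if σ ω < θ ω then σ ω else ρ ω := by
  intro t
  have hm : Measurable[ℱ t] fun ω => (min (σ ω) ((t : ℕ∞) + 1), min (θ ω) ((t : ℕ∞) + 1),
      min (ρ ω) ((t : ℕ∞) + 1)) :=
    (measurable_min_stoppingTime hσ t).prodMk
      ((measurable_min_stoppingTime hθ t).prodMk (measurable_min_stoppingTime hρ t))
  convert hm (MeasurableSet.of_discrete
    (s := {p : ℕ∞ × ℕ∞ × ℕ∞ | (if p.1 < p.2.1 then p.1 else p.2.2) ≤ t})) using 1
  ext ω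
  have hlt : (t : ℕ∞) < t + 1 := by exact_mod_cast Nat.lt_succ_self t
  have hle : ∀ x : ℕ∞, min x ((t : ℕ∞) + 1) ≤ t ↔ x ≤ t := fun x => by
    simp [not_le.2 hlt]
  simp only [Set.mem_ofPred_eq, Set.mem_preimage]
  change (if σ ω < θ ω then σ ω else ρ ω) ≤ (t : ℕ∞) ↔ _
  by_cases hσt : σ ω ≤ t
  · have h1 : min (σ ω) ((t : ℕ∞) + 1) = σ ω := min_eq_left (hσt.trans hlt.le)
    have h2 : σ ω < min (θ ω) ((t : ℕ∞) + 1) ↔ σ ω < θ ω := by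
      simp [hσt.trans_lt hlt]
    rw [h1]
    simp only [h2]
    split_ifs
    · rfl
    · exact (hle _).symm
  · have hρt : ¬ ρ ω ≤ t := fun h' => hσt ((h ω).trans h')
    constructor
    · intro h'
      split_ifs at h' <;> contradiction
    · intro h'
      split_ifs at h'
      · exact absurd ((hle _).1 h') hσt
      · exact absurd ((hle _).1 h') hρt

theorem theta_min (hN : 2 ≤ N) {n : ℕ} (hn : 0 < n) (τ : ℕ → Ω → ℕ∞) (b : ℕ∞) (ω : Ω) :
    theta N (fun l ω => min (τ l ω) b) n ω = min (theta N τ n ω) b := by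
  obtain ⟨l, h1, h2, h3⟩ := exists_theta_eq hN hn τ ω
  refine le_antisymm ?_ ?_
  · rw [← h3]
    exact theta_le (τ := fun l ω => min (τ l ω) b) h1 h2 ω
  · refine Finset.le_inf fun k hk => min_le_min_right _ ?_
    exact Finset.inf_le hk

/-- If `theta ≤ t`, the cap `t + 1` affects neither `theta` nor the set of players attaining it; if
`theta > t`, only that fact enters the reward. -/
theorem rewardU_min (hN : 2 ≤ N) {n : ℕ} (hn : 0 < n) (t : ℕ∞) (ω : Ω) :
    rewardU X (fun l ω => min (τ l ω) (t + 1)) n t ω = rewardU X τ n t ω := by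
  have hθ := theta_min hN hn τ (t + 1) ω
  by_cases h : theta N τ n ω ≤ t
  · have hle : theta N τ n ω ≤ t + 1 := h.trans le_self_add
    have hθ' : theta N (fun l ω => min (τ l ω) (t + 1)) n ω = theta N τ n ω := by
      rw [hθ, min_eq_left hle]
    refine rewardU_eq_of_theta_coalition rfl hθ' ?_ t
    have hiff : ∀ x : ℕ∞, min x (t + 1) = theta N τ n ω ↔ x = theta N τ n ω := by
      intro x
      rcases eq_or_ne t ⊤ with rfl | ht
      · simp
      · have hlt : theta N τ n ω < t + 1 := h.trans_lt (ENat.lt_add_one_iff ht |>.2 le_rfl)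
        constructor
        · intro hx
          rcases min_choice x (t + 1) with h' | h'
          · rw [← hx, h']
          · rw [h'] at hx
            exact absurd hx hlt.ne'
        · rintro rfl
          exact min_eq_left hle
    simp only [coalition, hθ', hiff]
  · have hlt : t < theta N τ n ω := not_le.1 h
    have hlt' : t < min (theta N τ n ω) (t + 1) :=
      lt_min hlt (ENat.lt_add_one_iff (ne_top_of_lt hlt) |>.2 le_rfl)
    rw [← hθ] at hlt'
    simp only [rewardU, if_pos hlt, if_pos hlt']

theorem measurable_rewardU_const (hN : 2 ≤ N)
    (hX : ∀ i I, I.Nonempty → ∀ t, Measurable[sigmaAt ℱ t] (X i I t)) {n : ℕ} (hn : 0 < n)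
    (v : ℕ → ℕ∞) (t : ℕ∞) :
    Measurable[sigmaAt ℱ t] (rewardU X (fun l _ => v l) n t) := by
  rcases isEmpty_or_nonempty Ω with hΩ | ⟨⟨ω₀⟩⟩
  · exact @measurable_of_empty _ _ (sigmaAt ℱ t) _ _ _
  set s := theta N (fun l (_ : Ω) => v l) n ω₀ with hs
  set C := coalition (N := N) (fun l (_ : Ω) => v l) n ω₀ with hC
  have hCne : C.Nonempty := coalition_nonempty hN hn _ _
  have hfun : rewardU X (fun l _ => v l) n t = fun ω =>
      if t < s then X (mover N n) {mover N n} t ω else if s < ⊤ then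
        max (X (mover N n) (C ∪ {mover N n}) s ω) (X (mover N n) C s ω)
      else X (mover N n) Finset.univ ⊤ ω := rfl
  rw [hfun]
  by_cases h1 : t < s
  · simpa only [if_pos h1] using hX _ _ (Finset.singleton_nonempty _) t
  · have hst := sigmaAt_mono ℱ (not_lt.1 h1)
    by_cases h2 : s < ⊤
    · simp only [if_neg h1, if_pos h2]
      exact ((hX _ _ hCne.inl s).max (hX _ _ hCne s)).mono hst le_rfl
    · have ht : t = ⊤ := top_le_iff.1 ((not_lt.1 h2).trans (not_lt.1 h1))
      subst ht
      simp only [if_neg h1, if_neg h2]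
      exact hX _ _ Finset.univ_nonempty ⊤

/-- The capped times take countably many values and are known at time `t`; on each piece the times
may be treated as deterministic. -/
theorem measurable_rewardU (hN : 2 ≤ N)
    (hX : ∀ i I, I.Nonempty → ∀ t, Measurable[sigmaAt ℱ t] (X i I t)) {n : ℕ} (hn : 0 < n)
    (hτ : ∀ l < n, IsStoppingTime ℱ (τ l)) (t : ℕ∞) :
    Measurable[sigmaAt ℱ t] (rewardU X τ n t) := by
  let ext : (Fin n → ℕ∞) → ℕ → ℕ∞ := fun v l => if h : l < n then v ⟨l, h⟩ else ⊤
  let c : Ω → Fin n → ℕ∞ := fun ω l => min (τ l ω) (t + 1)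
  have hfun : rewardU X τ n t = fun ω => rewardU X (fun l _ => ext (c ω) l) n t ω := by
    ext ω
    rw [← rewardU_min hN hn]
    refine rewardU_congr (fun k hk => ?_) t
    simp [ext, c, hk]
  rw [hfun]
  refine measurable_of_countable_selector
    (F := fun v => rewardU X (fun l _ => ext v l) n t) (fun v => ?_)
    fun v => measurable_rewardU_const hN hX hn _ t
  have : {ω | c ω = v} = ⋂ l, {ω | c ω l = v l} := by
    ext ω; simp [funext_iff]
  rw [this]
  exact MeasurableSet.iInter fun l =>
    measurable_min_stoppingTime (hτ l l.2) t (measurableSet_singleton _)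

theorem abs_rewardU_le (hN : 2 ≤ N) {n : ℕ} (hn : 0 < n) {ω : Ω} {g : ℝ}
    (h : ∀ i I, I.Nonempty → ∀ t, |X i I t ω| ≤ g) (t : ℕ∞) : |rewardU X τ n t ω| ≤ g := by
  have hC := coalition_nonempty hN hn τ ω
  rw [rewardU, rewardY]
  split_ifs
  · exact h _ _ (Finset.singleton_nonempty _) _
  · exact abs_max_le_max_abs_abs.trans (max_le (h _ _ hC.inl _) (h _ _ hC _))
  · exact h _ _ Finset.univ_nonempty _

/-- The sum of the suprema of all payoff processes. -/
def sumSup (X : Fin N → Finset (Fin N) → ℕ∞ → Ω → ℝ) (ω : Ω) : ENNReal :=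
  ∑ p : Fin N × Finset (Fin N) with p.2.Nonempty, ⨆ t : ℕ∞, ‖X p.1 p.2 t ω‖ₑ

/-- A variable dominating all the payoff processes. -/
def domination (X : Fin N → Finset (Fin N) → ℕ∞ → Ω → ℝ) (ω : Ω) : ℝ := (sumSup X ω).toReal

theorem enorm_le_sumSup (i : Fin N) {I : Finset (Fin N)} (hI : I.Nonempty) (t : ℕ∞) (ω : Ω) :
    ‖X i I t ω‖ₑ ≤ sumSup X ω := by
  have hmem : (i, I) ∈ Finset.univ.filter fun p : Fin N × Finset (Fin N) => p.2.Nonempty :=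
    Finset.mem_filter.2 ⟨Finset.mem_univ _, hI⟩
  exact (le_iSup (fun t => ‖X i I t ω‖ₑ) t).trans (Finset.single_le_sum_of_canonicallyOrdered
    (f := fun p : Fin N × Finset (Fin N) => ⨆ t : ℕ∞, ‖X p.1 p.2 t ω‖ₑ) hmem)

section Domination

variable (hX : ∀ i I, I.Nonempty → ∀ t, Measurable[sigmaAt ℱ t] (X i I t))
  (hX_sup : ∀ i I, I.Nonempty → ∫⁻ ω, ⨆ t : ℕ∞, ‖X i I t ω‖ₑ ∂P < ⊤)

include hX

theorem measurable_iSup_enorm (i : Fin N) {I : Finset (Fin N)} (hI : I.Nonempty) :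
    Measurable fun ω => ⨆ t : ℕ∞, ‖X i I t ω‖ₑ :=
  Measurable.iSup fun t => ((hX i I hI t).mono (sigmaAt_le ℱ t) le_rfl).enorm

theorem measurable_sumSup : Measurable (sumSup X) :=
  Finset.measurable_sum _ fun p hp => measurable_iSup_enorm hX p.1 (Finset.mem_filter.1 hp).2

include hX_sup

theorem lintegral_sumSup_lt_top : ∫⁻ ω, sumSup X ω ∂P < ⊤ := by
  simp only [sumSup]
  rw [lintegral_finsetSum _ fun p hp =>
    measurable_iSup_enorm hX p.1 (Finset.mem_filter.1 hp).2]
  exact ENNReal.sum_lt_top.2 fun p hp => hX_sup p.1 p.2 (Finset.mem_filter.1 hp).2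

theorem integrable_domination : Integrable (domination X) P :=
  integrable_toReal_of_lintegral_ne_top (measurable_sumSup hX).aemeasurable
    (lintegral_sumSup_lt_top hX hX_sup).ne

theorem ae_abs_le_domination :
    ∀ᵐ ω ∂P, ∀ i I, I.Nonempty → ∀ t, |X i I t ω| ≤ domination X ω := by
  filter_upwards [ae_lt_top (measurable_sumSup hX)
    (lintegral_sumSup_lt_top hX hX_sup).ne] with ω hω i I hI t
  have := ENNReal.toReal_mono hω.ne (enorm_le_sumSup i hI t ω)
  rwa [toReal_enorm, Real.norm_eq_abs] at this

theorem isDominated_rewardU (hN : 2 ≤ N) {n : ℕ} (hn : 0 < n)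
    (hτ : ∀ l < n, IsStoppingTime ℱ (τ l)) :
    IsDominated ℱ P (rewardU X τ n) (domination X) where
  measurable := measurable_rewardU hN hX hn hτ
  integrable := integrable_domination hX hX_sup
  bound := by
    filter_upwards [ae_abs_le_domination hX hX_sup] with ω h t using abs_rewardU_le hN hn h t

end Domination

/-- Measurability of `W n` is asked only once the earlier times are stopping times, so the lemma
also serves in the construction, where the envelopes are not yet known to exist. -/
theorem isStoppingTime_of_step (hN : 2 ≤ N)
    (hX : ∀ i I, I.Nonempty → ∀ t, Measurable[sigmaAt ℱ t] (X i I t))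
    (init : ∀ n < N, ∀ ω, τ n ω = ⊤)
    (hW : ∀ n, N ≤ n → (∀ l < n, IsStoppingTime ℱ (τ l)) → ∀ t, Measurable[sigmaAt ℱ t] (W n t))
    (step : ∀ n, N ≤ n → ∀ ω, τ n ω =
      if min (muTime X ε τ W n ω) (τ (n - N) ω) < theta N τ n ω then
        min (muTime X ε τ W n ω) (τ (n - N) ω)
      else τ (n - N) ω) (n : ℕ) : IsStoppingTime ℱ (τ n) := by
  induction n using Nat.strong_induction_on with
  | _ n ih =>
    by_cases hn : n < N
    · rw [show τ n = fun _ => ⊤ from funext (init n hn)]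
      exact isStoppingTime_top ℱ
    · rw [not_lt] at hn
      have hρ := ih (n - N) (by omega)
      have hμ : IsStoppingTime ℱ (muTime X ε τ W n) :=
        isStoppingTime_entryTime (measurable_rewardU hN hX (by omega) ih) (hW n hn ih) ε
      rw [show τ n = _ from funext (step n hn)]
      exact isStoppingTime_ite (σ := fun ω => min (muTime X ε τ W n ω) (τ (n - N) ω))
        (hμ.min hρ) (isStoppingTime_theta ih) hρ fun ω => min_le_right _ _

theorem IsApproxScheme.isStoppingTime (hτ : IsApproxScheme ℱ P X ε τ W) (hN : 2 ≤ N)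
    (hX : ∀ i I, I.Nonempty → ∀ t, Measurable[sigmaAt ℱ t] (X i I t)) (n : ℕ) :
    IsStoppingTime ℱ (τ n) :=
  isStoppingTime_of_step hN hX hτ.init (fun n hn _ t => (hτ.snell n hn t).measurable) hτ.step n

/-! ### Existence of the scheme -/

/-- Some version of the Snell envelope of `U` at time `t`, if there is one. -/
def snellVersion (ℱ : Filtration ℕ mΩ) (P : Measure Ω) (U : ℕ∞ → Ω → ℝ) (t : ℕ∞) : Ω → ℝ :=
  Classical.epsilon (IsSnellAt ℱ P U t)

/-- The sequence of the scheme, with the Snell envelopes chosen by `snellVersion`. -/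
def approxTime (ℱ : Filtration ℕ mΩ) (P : Measure Ω) (X : Fin N → Finset (Fin N) → ℕ∞ → Ω → ℝ)
    (ε : ℝ) (n : ℕ) : Ω → ℕ∞ :=
  let prev : ℕ → Ω → ℕ∞ := fun l => if _h : l < n then approxTime ℱ P X ε l else fun _ => ⊤
  let μ : Ω → ℕ∞ := muTime X ε prev (fun k => snellVersion ℱ P (rewardU X prev k)) n
  if n < N then fun _ => ⊤ else fun ω =>
    if min (μ ω) (prev (n - N) ω) < theta N prev n ω then min (μ ω) (prev (n - N) ω)
    else prev (n - N) ω
termination_by n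

theorem exists_isApproxScheme (hN : 2 ≤ N)
    (hX : ∀ i I, I.Nonempty → ∀ t, Measurable[sigmaAt ℱ t] (X i I t))
    (hX_sup : ∀ i I, I.Nonempty → ∫⁻ ω, ⨆ t : ℕ∞, ‖X i I t ω‖ₑ ∂P < ⊤) (ε : ℝ) :
    ∃ τ W, IsApproxScheme ℱ P X ε τ W := by
  let τ := approxTime ℱ P X ε
  let W : ℕ → ℕ∞ → Ω → ℝ := fun k => snellVersion ℱ P (rewardU X τ k)
  have init : ∀ n < N, ∀ ω, τ n ω = ⊤ := by
    intro n hn ω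
    simp only [τ]
    rw [approxTime]
    simp [hn]
  have step : ∀ n, N ≤ n → ∀ ω, τ n ω =
      if min (muTime X ε τ W n ω) (τ (n - N) ω) < theta N τ n ω then
        min (muTime X ε τ W n ω) (τ (n - N) ω)
      else τ (n - N) ω := by
    intro n hn ω
    -- The recursion replaces later times by `⊤`; this is harmless because step `n` reads only times
    -- with index below `n`.
    let prev : ℕ → Ω → ℕ∞ := fun l => if _h : l < n then τ l else fun _ => ⊤
    have hprev : ∀ k < n, prev k = τ k := fun k hk => by simp [prev, hk]
    have hU : rewardU X prev n = rewardU X τ n := by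
      ext t ω
      exact rewardU_congr (fun k hk => by rw [hprev k hk]) t
    have hμ : muTime X ε prev (fun k => snellVersion ℱ P (rewardU X prev k)) n ω =
        muTime X ε τ W n ω := by
      simp only [muTime, W, hU]
    have hθ : theta N prev n ω = theta N τ n ω := theta_congr fun k hk => by rw [hprev k hk]
    have h0 : n - N < n := Nat.sub_lt (by omega) (by omega)
    rw [← hμ, ← hθ, ← hprev (n - N) h0]
    change approxTime ℱ P X ε n ω = _
    rw [approxTime]
    simp only [not_lt.2 hn, if_false]
    rfl
  -- Choice by `Classical.epsilon` let the recursion be defined without proof that envelopes exist;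
  -- existence follows now, from the stopping-time property of the earlier times.
  have hsnell : ∀ n, N ≤ n → (∀ l < n, IsStoppingTime ℱ (τ l)) →
      ∀ t, IsSnellAt ℱ P (rewardU X τ n) t (W n t) := fun n hn h t =>
    Classical.epsilon_spec
      (exists_isSnellAt (isDominated_rewardU hX hX_sup hN (by omega) h) t)
  have hstopping : ∀ n, IsStoppingTime ℱ (τ n) :=
    isStoppingTime_of_step hN hX init (fun n hn h t => (hsnell n hn h t).measurable) step
  exact ⟨τ, W, init, fun n hn t => hsnell n hn (fun l _ => hstopping l) t, step⟩

end Scheme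

/-! ### Best responses along the scheme and passage to the limit. -/

section Nash


variable {Ω : Type*} {mΩ : MeasurableSpace Ω} {N : ℕ} [NeZero N]
variable {ℱ : Filtration ℕ mΩ} {P : Measure Ω} {X : Fin N → Finset (Fin N) → ℕ∞ → Ω → ℝ}
  {ε : ℝ} {τ : ℕ → Ω → ℕ∞} {W : ℕ → ℕ∞ → Ω → ℝ} {G : Ω → ℝ}

set_option linter.unusedSectionVars false

/-! ### Stopping at `τ n` is as good as stopping at the entry time -/

section EntryTime

variable [IsFiniteMeasure P] (hτ : IsApproxScheme ℱ P X ε τ W) (hN : 2 ≤ N)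
  (hX : ∀ i I, I.Nonempty → ∀ t, Measurable[sigmaAt ℱ t] (X i I t))
  (hX_sup : ∀ i I, I.Nonempty → ∫⁻ ω, ⨆ t : ℕ∞, ‖X i I t ω‖ₑ ∂P < ⊤)

include hτ hN hX hX_sup

theorem IsApproxScheme.isDominated {n : ℕ} (hn : N ≤ n) :
    IsDominated ℱ P (rewardU X τ n) (domination X) :=
  isDominated_rewardU hX hX_sup hN (by omega) fun l _ => hτ.isStoppingTime hN hX l

/-- From `theta` on the reward is frozen, so waiting gains nothing and the envelope drops to the
reward. -/
theorem IsApproxScheme.ae_muTime_le_theta (hε : 0 ≤ ε) {n : ℕ} (hn : N ≤ n) :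
    ∀ᵐ ω ∂P, muTime X ε τ W n ω ≤ theta N τ n ω := by
  have hθ : IsStoppingTime ℱ (theta N τ n) :=
    isStoppingTime_theta fun l _ => hτ.isStoppingTime hN hX l
  have h : ∀ᵐ ω ∂P, ∀ s : ℕ, theta N τ n ω = s → W n s ω ≤ rewardU X τ n s ω :=
    ae_all_iff.2 fun s => (hτ.snell n hn s).le_self_on
      (hτ.isDominated hN hX hX_sup hn) (A := {ω | theta N τ n ω = s})
      (measurableSet_stoppingTime_eq hθ s) fun ω hω t ht => by
        have hω' : theta N τ n ω = s := hω
        rw [rewardU_of_theta_le hω'.le, rewardU_of_theta_le (hω'.le.trans ht)]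
  filter_upwards [h] with ω h
  cases hs : theta N τ n ω with
  | top => exact le_top
  | coe s =>
    have := h s hs
    exact entryTime_le (U := rewardU X τ n) (W := W n) (by linarith)

/-- On this event the reward is that of step `n - N`, so by locality the envelopes agree as well and
`τ (n - N)` still meets the entry condition. -/
theorem IsApproxScheme.ae_muTime_le_of_lt_theta {n : ℕ} (hn : N ≤ n)
    (ih : ∀ᵐ ω ∂P, τ (n - N) ω < theta N τ (n - N) ω →
      W (n - N) (τ (n - N) ω) ω ≤ rewardU X τ (n - N) (τ (n - N) ω) ω + ε) :
    ∀ᵐ ω ∂P, τ (n - N) ω < theta N τ n ω → muTime X ε τ W n ω ≤ τ (n - N) ω := by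
  have hθ : IsStoppingTime ℱ (theta N τ n) :=
    isStoppingTime_theta fun l _ => hτ.isStoppingTime hN hX l
  by_cases h2 : N ≤ n - N
  · have h : ∀ᵐ ω ∂P, ∀ s : ℕ, ω ∈ {ω | τ (n - N) ω = s} ∩ {ω | (s : ℕ∞) < theta N τ n ω} →
        W n s ω ≤ W (n - N) s ω := by
      refine ae_all_iff.2 fun s => IsSnellAt.le_of_eqOn (hτ.isDominated hN hX hX_sup hn)
        (hτ.isDominated hN hX hX_sup h2) (hτ.snell n hn s) (hτ.snell (n - N) h2 s)
        ((measurableSet_stoppingTime_eq (hτ.isStoppingTime hN hX _) s).inter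
          (measurableSet_lt_stoppingTime hθ s)) ?_
      rintro ω ⟨h3, h4⟩
      exact (hτ.rewardU_eq_sub hN hn (show τ (n - N) ω < theta N τ n ω from
        (show τ (n - N) ω = s from h3) ▸ h4)).2
    filter_upwards [h, ih] with ω h ih hlt
    obtain ⟨hθ', hU⟩ := hτ.rewardU_eq_sub hN hn hlt
    obtain ⟨s, hs⟩ := ENat.ne_top_iff_exists.1 (ne_top_of_lt hlt)
    have h3 := h s ⟨hs.symm, by rw [hs]; exact hlt⟩
    have h4 := ih (hθ' ▸ hlt)
    rw [← hU, ← hs] at h4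
    rw [← hs]
    exact entryTime_le (U := rewardU X τ n) (W := W n) (h3.trans h4)
  · refine ae_of_all _ fun ω hlt => ?_
    rw [hτ.init (n - N) (by omega) ω] at hlt
    exact absurd hlt not_top_lt

theorem IsApproxScheme.ae_snell_le {n : ℕ} (hn : N ≤ n) :
    ∀ᵐ ω ∂P, τ n ω < theta N τ n ω → W n (τ n ω) ω ≤ rewardU X τ n (τ n ω) ω + ε := by
  induction n using Nat.strong_induction_on with
  | _ n ih =>
    have ih' : ∀ᵐ ω ∂P, τ (n - N) ω < theta N τ (n - N) ω →
        W (n - N) (τ (n - N) ω) ω ≤ rewardU X τ (n - N) (τ (n - N) ω) ω + ε := by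
      by_cases h2 : N ≤ n - N
      · exact ih (n - N) (by omega) h2
      · refine ae_of_all _ fun ω hlt => ?_
        rw [hτ.init (n - N) (by omega) ω] at hlt
        exact absurd hlt not_top_lt
    filter_upwards [hτ.ae_muTime_le_of_lt_theta hN hX hX_sup hn ih'] with ω h hlt
    -- Either the entry time is the new time, or the old time is kept and the entry time cannot be
    -- later than it.
    have hμ : muTime X ε τ W n ω = τ n ω := by
      have hstep := hτ.step n hn ω
      split_ifs at hstep with hc
      · rcases le_total (muTime X ε τ W n ω) (τ (n - N) ω) with h' | h'
        · rw [hstep, min_eq_left h']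
        · rw [min_eq_right h'] at hstep
          rw [hstep]
          exact le_antisymm (h (hstep ▸ hlt)) h'
      · rw [hstep] at hlt
        exact absurd (lt_of_le_of_lt (min_le_right _ _) hlt) hc
    exact entryTime_mem (U := rewardU X τ n) (W := W n) hμ (hlt.trans_le le_top)

theorem IsApproxScheme.ae_rewardU_eq (hε : 0 ≤ ε) {n : ℕ} (hn : N ≤ n) :
    ∀ᵐ ω ∂P, rewardU X τ n (τ n ω) ω = rewardU X τ n (muTime X ε τ W n ω) ω := by
  have ih' : ∀ᵐ ω ∂P, τ (n - N) ω < theta N τ (n - N) ω →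
      W (n - N) (τ (n - N) ω) ω ≤ rewardU X τ (n - N) (τ (n - N) ω) ω + ε := by
    by_cases h2 : N ≤ n - N
    · exact hτ.ae_snell_le hN hX hX_sup h2
    · refine ae_of_all _ fun ω hlt => ?_
      rw [hτ.init (n - N) (by omega) ω] at hlt
      exact absurd hlt not_top_lt
  filter_upwards [hτ.ae_muTime_le_of_lt_theta hN hX hX_sup hn ih',
    hτ.ae_muTime_le_theta hN hX hX_sup hε hn] with ω h1 h2
  have hstep := hτ.step n hn ω
  rcases lt_or_ge (τ (n - N) ω) (theta N τ n ω) with h3 | h3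
  · rw [min_eq_left (h1 h3), if_pos ((h1 h3).trans_lt h3)] at hstep
    rw [hstep]
  · rw [min_eq_left (h2.trans h3)] at hstep
    split_ifs at hstep with h4
    · rw [hstep]
    -- Both times lie at or after `theta`, where the reward no longer varies.
    · rw [rewardU_of_theta_le (not_lt.1 h4), hstep, rewardU_of_theta_le h3]

end EntryTime

/-! ### Payoffs -/

theorem payoff_eq (i : Fin N) (T : Fin N → Ω → ℕ∞) (ω : Ω) :
    payoff X i T ω = X i {j | T j ω = endTime T ω} (endTime T ω) ω := by
  rw [payoff, Finset.sum_eq_single ({j | T j ω = endTime T ω} : Finset (Fin N))]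
  · rw [Set.indicator_of_mem]
    refine ⟨fun j hj => (Finset.mem_filter.1 hj).2, fun j hj => ?_⟩
    exact lt_of_le_of_ne (iInf_le _ j) fun h => hj (Finset.mem_filter.2 ⟨Finset.mem_univ j, h.symm⟩)
  · rintro I - hI
    rw [Set.indicator_of_notMem]
    rintro ⟨h1, h2⟩
    refine hI ?_
    ext j
    rw [Finset.mem_filter]
    refine ⟨fun hj => ⟨Finset.mem_univ j, h1 j hj⟩, fun hj => ?_⟩
    by_contra hj'
    exact (h2 j hj').ne' hj.2
  · intro h
    obtain ⟨j, hj⟩ := exists_eq_ciInf_of_finite (f := fun j => T j ω)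
    exact absurd (Finset.mem_filter.2 ⟨Finset.mem_univ _, ⟨j, Finset.mem_filter.2
      ⟨Finset.mem_univ j, hj⟩⟩⟩) h

theorem filter_eq_endTime_nonempty (T : Fin N → Ω → ℕ∞) (ω : Ω) :
    ({j | T j ω = endTime T ω} : Finset (Fin N)).Nonempty := by
  obtain ⟨j, hj⟩ := exists_eq_ciInf_of_finite (f := fun j => T j ω)
  exact ⟨j, Finset.mem_filter.2 ⟨Finset.mem_univ j, hj⟩⟩

theorem payoff_congr {i : Fin N} {T T' : Fin N → Ω → ℕ∞} {ω : Ω} (h : ∀ j, T j ω = T' j ω) :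
    payoff X i T ω = payoff X i T' ω := by
  have h' : endTime T ω = endTime T' ω := iInf_congr h
  simp only [payoff_eq, h', h]

theorem payoff_eq_of_endTime {i : Fin N} {T : Fin N → Ω → ℕ∞} {ω : Ω} {r : ℕ∞}
    {C : Finset (Fin N)} (hr : ∀ j, r ≤ T j ω) (hC : ∀ j, j ∈ C ↔ T j ω = r)
    (hne : C.Nonempty) : payoff X i T ω = X i C r ω := by
  obtain ⟨j, hj⟩ := hne
  have hend : endTime T ω = r :=
    le_antisymm ((iInf_le _ j).trans ((hC j).1 hj).le) (le_iInf hr)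
  rw [payoff_eq, hend]
  congr 1
  ext k
  simp [hC]

theorem abs_payoff_le {i : Fin N} {T : Fin N → Ω → ℕ∞} {ω : Ω} {g : ℝ}
    (h : ∀ i I, I.Nonempty → ∀ t, |X i I t ω| ≤ g) : |payoff X i T ω| ≤ g := by
  rw [payoff_eq]
  exact h _ _ (filter_eq_endTime_nonempty T ω) _

theorem measurable_payoff (hX : ∀ i I, I.Nonempty → ∀ t, Measurable[sigmaAt ℱ t] (X i I t))
    (i : Fin N) {T : Fin N → Ω → ℕ∞} (hT : ∀ j, IsStoppingTime ℱ (T j)) :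
    Measurable (payoff X i T) := by
  let F : (Fin N → ℕ∞) → Ω → ℝ := fun v => X i {j | v j = ⨅ k, v k} (⨅ k, v k)
  have heq : payoff X i T = fun ω => F (fun j => T j ω) ω := by
    ext ω; exact payoff_eq i T ω
  rw [heq]
  refine measurable_of_countable_selector (c := fun ω j => T j ω) (F := F)
    (fun v => ?_) fun v => ?_
  · have : {ω | (fun j => T j ω) = v} = ⋂ j, {ω | T j ω = v j} := by
      ext ω; simp [funext_iff]
    rw [this]
    exact MeasurableSet.iInter fun j => measurable_stoppingTime (hT j) (measurableSet_singleton _)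
  · refine (hX i _ ?_ _).mono (sigmaAt_le ℱ _) le_rfl
    exact filter_eq_endTime_nonempty (fun j (_ : Unit) => v j) ()

/-! ### Strategy profiles along the scheme -/

/-- The last step up to `n` at which player `j` moves. -/
def lastStep (n : ℕ) (j : Fin N) : ℕ := N * ((n - j) / N) + j

/-- The current strategies of all players after step `n`. -/
def profile (τ : ℕ → Ω → ℕ∞) (n : ℕ) (j : Fin N) : Ω → ℕ∞ := τ (lastStep n j)

theorem mover_mul_add (q : ℕ) (j : Fin N) : mover N (N * q + j) = j := by
  ext
  simp [mover, Fin.ofNat, Nat.mod_eq_of_lt j.2]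

theorem mover_lastStep (n : ℕ) (j : Fin N) : mover N (lastStep n j) = j := mover_mul_add _ j

theorem lastStep_le {n : ℕ} (hn : N ≤ n) (j : Fin N) : lastStep n j ≤ n := by
  have := Nat.mul_div_le (n - j) N
  have := j.2
  unfold lastStep
  omega

theorem lt_lastStep_add (n : ℕ) (j : Fin N) : n < lastStep n j + N := by
  have := Nat.lt_mul_div_succ (n - j) (Nat.pos_of_neZero N)
  have := j.2
  unfold lastStep
  rw [Nat.mul_add] at *
  omega

theorem lastStep_mover {n l : ℕ} (hn : N ≤ n) (h₁ : n < l + N) (h₂ : l ≤ n) :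
    lastStep n (mover N l) = l := by
  have h3 := mover_lastStep n (mover N l)
  have h4 := lastStep_le hn (mover N l)
  have h5 := lt_lastStep_add n (mover N l)
  rcases lt_trichotomy (lastStep n (mover N l)) l with h | h | h
  · exact absurd h3 (mover_injOn h (by omega))
  · exact h
  · exact absurd h3.symm (mover_injOn h (by omega))

theorem lastStep_lt {n : ℕ} (hn : N ≤ n) {j : Fin N} (hj : j ≠ mover N n) : lastStep n j < n :=
  lt_of_le_of_ne (lastStep_le hn j) fun h => hj (by rw [← mover_lastStep n j, h])

theorem profile_mover {n : ℕ} (hn : N ≤ n) : profile τ n (mover N n) = τ n := by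
  rw [profile, lastStep_mover hn (by have := Nat.pos_of_neZero N; omega) le_rfl]

theorem theta_le_profile {n : ℕ} (hn : N ≤ n) {j : Fin N} (hj : j ≠ mover N n) (ω : Ω) :
    theta N τ n ω ≤ profile τ n j ω :=
  theta_le (lt_lastStep_add n j) (lastStep_lt hn hj) ω

theorem mem_coalition_iff {n : ℕ} (hn : N ≤ n) {ω : Ω} {j : Fin N} :
    j ∈ coalition τ n ω ↔ j ≠ mover N n ∧ profile τ n j ω = theta N τ n ω := by
  rw [mem_coalition]
  constructor
  · rintro ⟨l, h1, h2, h3, rfl⟩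
    exact ⟨mover_injOn h2 h1, by rw [profile, lastStep_mover hn h1 h2.le, h3]⟩
  · rintro ⟨h1, h2⟩
    exact ⟨_, lt_lastStep_add n j, lastStep_lt hn h1, h2, mover_lastStep n j⟩

section Deviation

variable {n : ℕ} (hn : N ≤ n) (S : Ω → ℕ∞) {ω : Ω}

include hn

theorem payoff_update_of_lt (h : S ω < theta N τ n ω) :
    payoff X (mover N n) (Function.update (profile τ n) (mover N n) S) ω =
      X (mover N n) {mover N n} (S ω) ω := by
  refine payoff_eq_of_endTime (fun j => ?_) (fun j => ?_) (Finset.singleton_nonempty _)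
  all_goals rcases eq_or_ne j (mover N n) with rfl | hj
  · simp
  · simpa [hj] using h.le.trans (theta_le_profile hn hj ω)
  · simp
  · simpa [hj] using (h.trans_le (theta_le_profile hn hj ω)).ne'

theorem payoff_update_of_eq (h : S ω = theta N τ n ω) :
    payoff X (mover N n) (Function.update (profile τ n) (mover N n) S) ω =
      X (mover N n) (coalition τ n ω ∪ {mover N n}) (theta N τ n ω) ω := by
  refine payoff_eq_of_endTime (fun j => ?_) (fun j => ?_) (Finset.singleton_nonempty _).inr
  all_goals rcases eq_or_ne j (mover N n) with rfl | hj
  · simp [h]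
  · simpa [hj] using theta_le_profile hn hj ω
  · simp [h]
  · simp [hj, mem_coalition_iff hn]

theorem payoff_update_of_gt (hN : 2 ≤ N) (h : theta N τ n ω < S ω) :
    payoff X (mover N n) (Function.update (profile τ n) (mover N n) S) ω =
      X (mover N n) (coalition τ n ω) (theta N τ n ω) ω := by
  refine payoff_eq_of_endTime (fun j => ?_) (fun j => ?_) (coalition_nonempty hN (by omega) τ ω)
  all_goals rcases eq_or_ne j (mover N n) with rfl | hj
  · simpa using h.le
  · simpa [hj] using theta_le_profile hn hj ω
  · simp [h.ne', mem_coalition_iff hn]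
  · simp [hj, mem_coalition_iff hn]

theorem coalition_union_eq_univ (h : theta N τ n ω = ⊤) :
    coalition τ n ω ∪ {mover N n} = Finset.univ := by
  ext j
  rcases eq_or_ne j (mover N n) with rfl | hj
  · simp
  · have := theta_le_profile (τ := τ) hn hj ω
    rw [h, top_le_iff] at this
    simp [mem_coalition_iff hn, hj, h, this]

theorem payoff_update_le_rewardU (hN : 2 ≤ N) :
    payoff X (mover N n) (Function.update (profile τ n) (mover N n) S) ω ≤
      rewardU X τ n (S ω) ω := by
  rcases lt_trichotomy (S ω) (theta N τ n ω) with h | h | h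
  · rw [payoff_update_of_lt hn S h, rewardU, if_pos h]
  · rw [payoff_update_of_eq hn S h, rewardU_of_theta_le h.ge, rewardY]
    split_ifs with h'
    · exact le_max_left _ _
    -- If nobody stops at a finite time, the full coalition is formed at `⊤`, as the definition of
    -- `rewardY` prescribes.
    · have htop : theta N τ n ω = ⊤ := not_lt_top_iff.1 h'
      rw [coalition_union_eq_univ hn htop, htop]
  · rw [payoff_update_of_gt hn S hN h, rewardU_of_theta_le h.le, rewardY,
      if_pos (h.trans_le le_top)]
    exact le_max_right _ _

end Deviation

theorem IsApproxScheme.exists_coalition_eq (hτ : IsApproxScheme ℱ P X ε τ W) (hN : 2 ≤ N) {n : ℕ}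
    (hn : N ≤ n) {ω : Ω} (h : theta N τ n ω < ⊤) : ∃ j, coalition (N := N) τ n ω = {j} := by
  obtain ⟨l, h1, h2, h3⟩ := exists_theta_eq hN (show 0 < n by omega) τ ω
  refine ⟨mover N l, ?_⟩
  ext j
  rw [mem_coalition, Finset.mem_singleton]
  constructor
  · rintro ⟨k, h4, h5, h6, rfl⟩
    rcases lt_trichotomy k l with hkl | rfl | hkl
    · have := hτ.eq_top_of_eq hkl (by omega) (h6.trans h3.symm)
      exact absurd (h3 ▸ this) h.ne
    · rfl
    · have := hτ.eq_top_of_eq hkl (by omega) (h3.trans h6.symm)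
      exact absurd (h6 ▸ this) h.ne
  · rintro rfl
    exact ⟨l, h1, h2, h3, rfl⟩

/-- The only possible gap is the maximum in `rewardY`. When `theta` comes first, a single opponent
stops there and (A) makes waiting the larger option; a tie with `theta` is possible only at `⊤`. -/
theorem IsApproxScheme.rewardU_eq_payoff (hτ : IsApproxScheme ℱ P X ε τ W) (hN : 2 ≤ N) {n : ℕ}
    (hn : N ≤ n) {ω : Ω} (hA : ∀ i j, ∀ t : ℕ, X i {i, j} t ω ≤ X i {j} t ω) :
    rewardU X τ n (τ n ω) ω = payoff X (mover N n) (profile τ n) ω := by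
  have hup : profile τ n = Function.update (profile τ n) (mover N n) (τ n) := by
    rw [← profile_mover (τ := τ) hn, Function.update_eq_self]
  rw [hup]
  rcases lt_trichotomy (τ n ω) (theta N τ n ω) with h | h | h
  · rw [payoff_update_of_lt hn _ h, rewardU, if_pos h]
  · have htop : theta N τ n ω = ⊤ := by
      obtain ⟨l, h1, h2, h3⟩ := exists_theta_eq hN (show 0 < n by omega) τ ω
      rw [← h]
      exact hτ.eq_top_of_eq h2 h1 (h3.trans h.symm)
    rw [payoff_update_of_eq hn _ h, rewardU_of_theta_le h.ge, rewardY,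
      coalition_union_eq_univ hn htop, htop, if_neg (lt_irrefl _)]
  · rw [payoff_update_of_gt hn _ hN h, rewardU_of_theta_le h.le, rewardY,
      if_pos (h.trans_le le_top)]
    refine max_eq_right ?_
    obtain ⟨j, hj⟩ := hτ.exists_coalition_eq hN hn (h.trans_le le_top)
    obtain ⟨s, hs⟩ := ENat.ne_top_iff_exists.1 (ne_top_of_lt h)
    rw [hj, ← hs, Finset.union_comm]
    exact hA _ j s

/-! ### The limit -/

theorem IsApproxScheme.antitone (hτ : IsApproxScheme ℱ P X ε τ W) (i : Fin N) (ω : Ω) :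
    Antitone fun q : ℕ => τ (N * q + i) ω := by
  refine antitone_nat_of_succ_le fun q => ?_
  have := hτ.le_sub (n := N * (q + 1) + i) (by rw [Nat.mul_add]; omega) ω
  rwa [show N * (q + 1) + i - N = N * q + i by rw [Nat.mul_add]; omega] at this

/-- The limit of the strategies of player `j`. -/
def limitTime (τ : ℕ → Ω → ℕ∞) (j : Fin N) (ω : Ω) : ℕ∞ := ⨅ q : ℕ, τ (N * q + j) ω

theorem IsApproxScheme.eventually_eq_limitTime (hτ : IsApproxScheme ℱ P X ε τ W) (j : Fin N)
    (ω : Ω) : ∀ᶠ q in atTop, τ (N * q + j) ω = limitTime τ j ω := by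
  -- Well-foundedness of ℕ ∪ {∞} makes the infimum attained.
  obtain ⟨q₀, hq₀⟩ := ciInf_mem fun q : ℕ => τ (N * q + j) ω
  filter_upwards [eventually_ge_atTop q₀] with q hq
  exact le_antisymm ((hτ.antitone j ω hq).trans hq₀.le) (iInf_le (fun q : ℕ => τ (N * q + j) ω) q)

theorem IsApproxScheme.eventually_profile_eq (hτ : IsApproxScheme ℱ P X ε τ W) (i : Fin N)
    (ω : Ω) : ∀ᶠ q in atTop, ∀ j : Fin N, profile τ (N * (q + 1) + i) j ω = limitTime τ j ω := by
  refine eventually_all.2 fun j => ?_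
  have hlim : Tendsto (fun q => (N * (q + 1) + i - j) / N) atTop atTop := by
    refine tendsto_atTop_mono (fun q => ?_) tendsto_id
    rw [id, Nat.le_div_iff_mul_le (Nat.pos_of_neZero N), Nat.mul_add, Nat.mul_comm]
    have := j.2
    omega
  exact hlim.eventually (hτ.eventually_eq_limitTime j ω)

theorem isStoppingTime_limitTime (h : ∀ n, IsStoppingTime ℱ (τ n)) (j : Fin N) :
    IsStoppingTime ℱ (limitTime τ j) := by
  intro t
  have : {ω | limitTime τ j ω ≤ (t : ℕ∞)} = ⋃ q : ℕ, {ω | τ (N * q + j) ω ≤ (t : ℕ∞)} := by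
    ext ω
    simp only [Set.mem_ofPred_eq, Set.mem_iUnion]
    constructor
    · intro h
      obtain ⟨q, hq⟩ := ciInf_mem fun q : ℕ => τ (N * q + j) ω
      exact ⟨q, hq.le.trans h⟩
    · rintro ⟨q, hq⟩
      exact (iInf_le (fun q : ℕ => τ (N * q + j) ω) q).trans hq
  change MeasurableSet[ℱ t] {ω | limitTime τ j ω ≤ (t : ℕ∞)}
  rw [this]
  exact MeasurableSet.iUnion fun q => h _ t

theorem isStoppingTime_update {T : Fin N → Ω → ℕ∞} (hT : ∀ j, IsStoppingTime ℱ (T j)) (i : Fin N)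
    {S : Ω → ℕ∞} (hS : IsStoppingTime ℱ S) (j : Fin N) :
    IsStoppingTime ℱ (Function.update T i S j) := by
  rcases eq_or_ne j i with rfl | hj
  · simpa using hS
  · simpa [hj] using hT j

section Equilibrium

variable (hX : ∀ i I, I.Nonempty → ∀ t, Measurable[sigmaAt ℱ t] (X i I t))
  (hX_sup : ∀ i I, I.Nonempty → ∫⁻ ω, ⨆ t : ℕ∞, ‖X i I t ω‖ₑ ∂P < ⊤)

include hX hX_sup

theorem integrable_payoff (i : Fin N) {T : Fin N → Ω → ℕ∞} (hT : ∀ j, IsStoppingTime ℱ (T j)) :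
    Integrable (payoff X i T) P := by
  refine (integrable_domination hX hX_sup).mono' (measurable_payoff hX i hT).aestronglyMeasurable ?_
  filter_upwards [ae_abs_le_domination hX hX_sup] with ω h using abs_payoff_le h

/-- Pathwise the payoffs are eventually constant in `q`, so no regularity of `X` in time is needed.
-/
theorem tendsto_integral_payoff (i : Fin N) {T : ℕ → Fin N → Ω → ℕ∞} {T' : Fin N → Ω → ℕ∞}
    (hT : ∀ q j, IsStoppingTime ℱ (T q j))
    (hlim : ∀ ω, ∀ᶠ q in atTop, ∀ j, T q j ω = T' j ω) :
    Tendsto (fun q => ∫ ω, payoff X i (T q) ω ∂P) atTop (𝓝 (∫ ω, payoff X i T' ω ∂P)) := by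
  refine tendsto_integral_of_dominated_convergence (domination X)
    (fun q => (measurable_payoff hX i (hT q)).aestronglyMeasurable)
    (integrable_domination hX hX_sup) (fun q => ?_) (ae_of_all _ fun ω => ?_)
  · filter_upwards [ae_abs_le_domination hX hX_sup] with ω h using abs_payoff_le h
  · refine tendsto_const_nhds.congr' ?_
    filter_upwards [hlim ω] with q hq using (payoff_congr hq).symm

theorem IsApproxScheme.integral_payoff_update_le [IsProbabilityMeasure P]
    (hτ : IsApproxScheme ℱ P X ε τ W) (hN : 2 ≤ N) (hε : 0 < ε)
    (hA : ∀ i j, ∀ t : ℕ, ∀ᵐ ω ∂P, X i {i, j} t ω ≤ X i {j} t ω) {n : ℕ} (hn : N ≤ n)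
    {S : Ω → ℕ∞} (hS : IsStoppingTime ℱ S) :
    ∫ ω, payoff X (mover N n) (Function.update (profile τ n) (mover N n) S) ω ∂P ≤
      ∫ ω, payoff X (mover N n) (profile τ n) ω ∂P + ε := by
  have hstopping := hτ.isStoppingTime hN hX
  have hU := hτ.isDominated hN hX hX_sup hn
  have hA' : ∀ᵐ ω ∂P, ∀ i j, ∀ t : ℕ, X i {i, j} t ω ≤ X i {j} t ω :=
    ae_all_iff.2 fun i => ae_all_iff.2 fun j => ae_all_iff.2 fun t => hA i j t
  calc ∫ ω, payoff X (mover N n) (Function.update (profile τ n) (mover N n) S) ω ∂P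
      ≤ ∫ ω, rewardU X τ n (S ω) ω ∂P :=
        integral_mono (integrable_payoff hX hX_sup _
          (isStoppingTime_update (fun j => hstopping _) _ hS)) (hU.integrable_stopped hS)
          fun ω => payoff_update_le_rewardU hn S hN
    _ ≤ ∫ ω, rewardU X τ n (muTime X ε τ W n ω) ω ∂P + ε :=
        integral_stopped_le_entryTime hε hU (hτ.snell n hn) hS
    _ = ∫ ω, payoff X (mover N n) (profile τ n) ω ∂P + ε := by
        congr 1
        refine integral_congr_ae ?_
        filter_upwards [hτ.ae_rewardU_eq hN hX hX_sup hε.le hn, hA'] with ω h1 h2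
        rw [← h1, hτ.rewardU_eq_payoff hN hn h2]

theorem IsApproxScheme.isNashEquilibrium [IsProbabilityMeasure P]
    (hτ : IsApproxScheme ℱ P X ε τ W) (hN : 2 ≤ N) (hε : 0 < ε)
    (hA : ∀ i j, ∀ t : ℕ, ∀ᵐ ω ∂P, X i {i, j} t ω ≤ X i {j} t ω) :
    IsNashEquilibrium ℱ P X ε (limitTime τ) where
  isStoppingTime := isStoppingTime_limitTime (hτ.isStoppingTime hN hX)
  le_add := by
    intro i S hS
    have hstopping := hτ.isStoppingTime hN hX
    have hlim := hτ.eventually_profile_eq i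
    have h1 := tendsto_integral_payoff hX hX_sup i (P := P)
      -- The inequality is used only at the steps of player `i`; the shift `q + 1` skips the initial
      -- round.
      (T := fun q => Function.update (profile τ (N * (q + 1) + i)) i S)
      (T' := Function.update (limitTime τ) i S)
      (fun q => isStoppingTime_update (fun j => hstopping _) i hS) (fun ω => by
        filter_upwards [hlim ω] with q hq j
        rcases eq_or_ne j i with rfl | hj
        · simp
        · simpa [hj] using hq j)
    have h2 := tendsto_integral_payoff hX hX_sup i (P := P)
      (T := fun q => profile τ (N * (q + 1) + i)) (fun q j => hstopping _) hlim
    refine le_of_tendsto_of_tendsto' h1 (h2.add_const ε) fun q => ?_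
    have := hτ.integral_payoff_update_le hX hX_sup hN hε hA
      (n := N * (q + 1) + i) (by rw [Nat.mul_add]; omega) hS
    rwa [mover_mul_add] at this

end Equilibrium

end Nash

end DynkinGame

end

theorem theorem4p6 {Ω : Type*} {mΩ : MeasurableSpace Ω} (P : Measure Ω) [IsProbabilityMeasure P]
    (ℱ : Filtration ℕ mΩ) {N : ℕ} [NeZero N] (hN : 2 ≤ N)
    (X : Fin N → Finset (Fin N) → ℕ∞ → Ω → ℝ)
    (hX_adapted : ∀ i I, I.Nonempty → ∀ t, Measurable[DynkinGame.sigmaAt ℱ t] (X i I t))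
    (hX_sup : ∀ i I, I.Nonempty → ∫⁻ ω, ⨆ t : ℕ∞, ‖X i I t ω‖ₑ ∂P < ⊤)
    (hA : ∀ i j, ∀ t : ℕ, ∀ᵐ ω ∂P, X i {i, j} t ω ≤ X i {j} t ω)
    (ε : ℝ) (hε : 0 < ε) :
    (∃ τ W, DynkinGame.IsApproxScheme ℱ P X ε τ W) ∧
    ∀ τ W, DynkinGame.IsApproxScheme ℱ P X ε τ W →
      (∀ n, IsStoppingTime ℱ (τ n)) ∧
      (∀ i : Fin N, ∀ ω, Antitone fun q : ℕ => τ (N * q + i) ω) ∧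
      ∃ T : Fin N → Ω → ℕ∞,
        (∀ (i : Fin N) ω, Tendsto (fun q : ℕ => τ (N * q + i) ω) atTop (𝓝 (T i ω))) ∧
        DynkinGame.IsNashEquilibrium ℱ P X ε T := by
  refine ⟨DynkinGame.exists_isApproxScheme hN hX_adapted hX_sup ε, fun τ W hτ =>
    ⟨hτ.isStoppingTime hN hX_adapted, hτ.antitone, DynkinGame.limitTime τ, fun i ω => ?_,
      hτ.isNashEquilibrium hX_adapted hX_sup hN hε hA⟩⟩
  exact tendsto_const_nhds.congr' ((hτ.eventually_eq_limitTime i ω).mono fun q hq => hq.symm)
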